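/- Let $d$ be a prime and $N\ge 0$ an integer, and let $\mathcal H=(\mathbb C^d)^{\otimes N}$ with computational basis $\{|j\rangle : j\in\mathbb Z_d^N\}$. Put $\omega=e^{2\pi i/d}$, $\zeta=e^{\pi i/d}$, and $X^{p}|j\rangle=|p+j\rangle$, $Z^{q}|j\rangle=\omega^{q\cdot j}|j\rangle$ for $p,q\in\mathbb Z_d^N$. The Pauli group is $\mathcal P=\{(-1)^x\zeta^k X^pZ^q : x\in\mathbb Z_2,\ k\in\mathbb Z_d,\ p,q\in\mathbb Z_d^N\}$, and the Clifford group $\mathcal C$ is its normalizer in the unitary group of $\mathcal H$. Write $\mathbb V=\mathbb Z_d^N\times\mathbb Z_d^N$. For a density operator $\rho$ of a pure state define: * for odd $d$, the mana $\mathcal M(\rho)=\log\sum_{\chi\in\mathbb V}|W_\chi(\rho)|$, where $W_\chi(\rho)=d^{-N}\operatorname{Tr}(\rho A_\chi)$, $A_\chi=d^{-N}\sum_{\chi'\in\mathbb V}\omega^{-\langle\chi,\chi'\rangle}T_{\chi'}$, $T_{(p,q)}=\omega^{2^{-1}p\cdot q}X^pZ^q$ with $2^{-1}$ the inverse of $2$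 in $\mathbb Z_d$, and $\langle(p,q),(p',q')\rangle=p\cdot q'-q\cdot p'$; * for real $\alpha>0$, $\alpha\ne1$, the stabilizer $\alpha$-Rényi entropy $M_\alpha(\rho)=\frac1{1-\alpha}\log\Bigl[d^{-(1-\alpha)N}\sum_{(p,q)\in\mathbb V}P_{p,q}(\rho)^\alpha\Bigr]$, where $P_{p,q}(\rho)=d^{-N}|\operatorname{Tr}(\rho X^pZ^q)|^2$; * the stabilizer fidelity $F(\rho)=\max_{s}|\langle s|\rho|s\rangle|$, the maximum being over the stabilizer states $s$, i.e. the unit vectors fixed by all elements of some Abelian subgroup of order $d^N$ of $\mathcal P$. A point $x^*$ is called an extremal point of a continuous function $f:\mathbb R\to\mathbb R$ if $f'(x^*)$ exists and is $0$, or $x^*$ is a local minimum or a local maximum of $f$, or $f$ is constant near $x^*$. For a set $M$ of operators on $\mathcal H$, a point $\rho_0\in M$ and a function $f$ on $M$, we say that $\rho_0$ is an extremal point of $f$ restricted to $M$ if for every $C^\infty$ curve $\gamma:\mathbb R\to M$ with $\gamma(0)=\rho_0$ the function $t\mapsto f(\gamma(t))$ is continuous and has $0$ as an extremal point. Let $\mathcal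 Q\subset\mathcal C$ be a finite subgroup, let $\mathcal S_{\mathcal Q}=\{v\in\mathcal H : gv=v\ \ \forall g\in\mathcal Q\}$ be its stabilized subspace, let $|\psi\rangle\in\mathcal S_{\mathcal Q}$ be a normalized vector, and let $\psi=|\psi\rangle\langle\psi|$. Let $\varrho_{\psi;\mathcal Q}$ be the set of all rank-one density operators $|\phi\rangle\langle\phi|$, $\|\phi\|=1$, whose support lies in $\operatorname{Span}\{|\psi\rangle\}\oplus\mathcal S_{\mathcal Q}^{\perp}$. Then $\psi$ is an extremal point of each of the following functions restricted to $\varrho_{\psi;\mathcal Q}$: 1. the mana $\mathcal M$, if $d$ is odd; 2. the stabilizer $\alpha$-Rényi entropy $M_\alpha$, for every real $\alpha>0$ with $\alpha\neq1$; 3. the stabilizer fidelity $F$. -/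

import Mathlib

open scoped Matrix ContDiff

noncomputable section

namespace QuditMagic

/-! ### The `N`-qudit Hilbert space -/

/-- Labels of the computational basis of `(ℂ^d)^{⊗N}`. -/
abbrev Label (d N : ℕ) : Type := Fin N → ZMod d

/-- The Hilbert space `(ℂ^d)^{⊗N}`, in coordinates with respect to the computational basis. -/
abbrev Hilb (d N : ℕ) : Type := EuclideanSpace ℂ (Label d N)

/-- Operators on the Hilbert space, as matrices in the computational basis. -/
abbrev Op (d N : ℕ) : Type := Matrix (Label d N) (Label d N) ℂ

/-- The discrete phase space `ℤ_d^N × ℤ_d^N`. -/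
abbrev Phase (d N : ℕ) : Type := Label d N × Label d N

section

variable {d N : ℕ} [Fact d.Prime]

/-- `ω ^ x` for `x ∈ ℤ_d`, where `ω = exp (2 π i / d)`. -/
def omegaPow (x : ZMod d) : ℂ := ZMod.stdAddChar x

/-- `ζ = exp (π i / d)`. -/
def zeta (d : ℕ) : ℂ := Complex.exp (Real.pi * Complex.I / d)

/-- `X^a`: sends the basis vector `j` to the basis vector `a + j`. -/
def shiftOp (a : Label d N) : Op d N := Matrix.of fun i j => if i = a + j then 1 else 0

/-- `Z^b`: multiplies the basis vector `j` by `ω ^ (b · j)`. -/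
def clockOp (b : Label d N) : Op d N := Matrix.diagonal fun j => omegaPow (b ⬝ᵥ j)

/-- `X^a Z^b`. -/
def pauliOp (a b : Label d N) : Op d N := shiftOp a * clockOp b

/-! Facts that make the Pauli operators a group. -/

lemma omegaPow_add (x y : ZMod d) : omegaPow (x + y) = omegaPow x * omegaPow y :=
  AddChar.map_add_eq_mul _ _ _

lemma omegaPow_zero : omegaPow (0 : ZMod d) = 1 := AddChar.map_zero_eq_one _

lemma omegaPow_eq_zeta_pow (x : ZMod d) : omegaPow x = zeta d ^ (2 * x.val) := by
  have h : omegaPow x = Complex.exp (2 * Real.pi * Complex.I * (x.val : ℤ) / d) := by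
    rw [← ZMod.stdAddChar_coe, omegaPow]; simp
  rw [h, zeta, ← Complex.exp_nat_mul]
  congr 1
  push_cast
  ring

lemma zeta_pow_two_mul : zeta d ^ (2 * d) = 1 := by
  have hd : (d : ℂ) ≠ 0 := Nat.cast_ne_zero.mpr (NeZero.ne d)
  rw [zeta, ← Complex.exp_nat_mul, ← Complex.exp_two_pi_mul_I]
  congr 1
  push_cast
  field_simp

lemma pauliOp_apply (a b i j : Label d N) :
    pauliOp a b i j = if i = a + j then omegaPow (b ⬝ᵥ j) else 0 := by
  simp [pauliOp, shiftOp, clockOp, Matrix.mul_diagonal]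

lemma pauliOp_zero : pauliOp (0 : Label d N) 0 = 1 := by
  ext i j
  simp [pauliOp_apply, Matrix.one_apply, omegaPow_zero]

lemma pauliOp_mul (a b a' b' : Label d N) :
    pauliOp a b * pauliOp a' b' = omegaPow (b ⬝ᵥ a') • pauliOp (a + a') (b + b') := by
  ext i j
  simp only [Matrix.mul_apply, pauliOp_apply, Matrix.smul_apply, smul_eq_mul, mul_ite, mul_zero,
    Finset.sum_ite_eq', Finset.mem_univ, if_true]
  rw [← add_assoc]
  split_ifs with h
  · rw [← omegaPow_add, ← omegaPow_add]
    congr 1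
    simp [dotProduct_add, add_dotProduct]
    ring
  · simp

/-- The generalized Pauli group: all `ζ^m X^a Z^b`. The powers of `ζ` are exactly the phases
`(-1)^x ζ^k` with `x ∈ ℤ_2` and `k ∈ ℤ_d`, since `ζ^d = -1`. -/
def pauliGroup (d N : ℕ) [Fact d.Prime] : Subgroup (Matrix.unitaryGroup (Label d N) ℂ) where
  carrier := {U | ∃ (m : ℕ) (a b : Label d N), (U : Op d N) = zeta d ^ m • pauliOp a b}
  one_mem' := ⟨0, 0, 0, by simp [pauliOp_zero]⟩
  mul_mem' := by
    rintro U V ⟨m, a, b, hU⟩ ⟨m', a', b', hV⟩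
    refine ⟨m + m' + 2 * (b ⬝ᵥ a').val, a + a', b + b', ?_⟩
    rw [Matrix.UnitaryGroup.mul_val, hU, hV, Matrix.smul_mul, Matrix.mul_smul, pauliOp_mul,
      omegaPow_eq_zeta_pow, smul_smul, smul_smul, pow_add, pow_add, mul_assoc]
  inv_mem' := by
    rintro U ⟨m, a, b, hU⟩
    -- an explicit right inverse of the right form
    let n : ℕ := (2 * d - 1) * m + (2 * d - 1) * (2 * (b ⬝ᵥ (-a)).val)
    refine ⟨n, -a, -b, ?_⟩
    have hz : ∀ k : ℕ, zeta d ^ k * zeta d ^ ((2 * d - 1) * k) = 1 := by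
      intro k
      have hd : 0 < d := NeZero.pos d
      have : k + (2 * d - 1) * k = 2 * d * k := by
        obtain ⟨e, rfl⟩ : ∃ e, d = e + 1 := ⟨d - 1, by omega⟩
        have : 2 * (e + 1) - 1 = 2 * e + 1 := by omega
        rw [this]; ring
      rw [← pow_add, this, pow_mul, zeta_pow_two_mul, one_pow]
    have h1 : (U : Op d N) * (zeta d ^ n • pauliOp (-a) (-b)) = 1 := by
      rw [hU, Matrix.smul_mul, Matrix.mul_smul, pauliOp_mul, omegaPow_eq_zeta_pow]
      simp only [add_neg_cancel, pauliOp_zero, smul_smul]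
      have : zeta d ^ m * (zeta d ^ n * zeta d ^ (2 * (b ⬝ᵥ (-a)).val)) = 1 := by
        simp only [n, pow_add]
        calc _ = (zeta d ^ m * zeta d ^ ((2 * d - 1) * m)) *
              (zeta d ^ (2 * (b ⬝ᵥ (-a)).val) *
                zeta d ^ ((2 * d - 1) * (2 * (b ⬝ᵥ (-a)).val))) := by ring
          _ = 1 := by rw [hz, hz, one_mul]
      rw [this, one_smul]
    have h2 : ((U⁻¹ : Matrix.unitaryGroup (Label d N) ℂ) : Op d N) * (U : Op d N) = 1 := by
      rw [← Matrix.UnitaryGroup.mul_val, inv_mul_cancel]; rfl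
    calc ((U⁻¹ : Matrix.unitaryGroup (Label d N) ℂ) : Op d N)
        = ((U⁻¹ : Matrix.unitaryGroup (Label d N) ℂ) : Op d N) *
            ((U : Op d N) * (zeta d ^ n • pauliOp (-a) (-b))) := by rw [h1, mul_one]
      _ = zeta d ^ n • pauliOp (-a) (-b) := by rw [← mul_assoc, h2, one_mul]

/-- The Clifford group: the normalizer of the Pauli group in the unitary group. -/
def cliffordGroup (d N : ℕ) [Fact d.Prime] : Subgroup (Matrix.unitaryGroup (Label d N) ℂ) :=
  Subgroup.normalizer (pauliGroup d N : Set (Matrix.unitaryGroup (Label d N) ℂ))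

/-- The stabilized subspace of a group `Q` of unitaries: vectors fixed by every `g ∈ Q`. -/
def stabilizedSpace (Q : Subgroup (Matrix.unitaryGroup (Label d N) ℂ)) :
    Submodule ℂ (Hilb d N) where
  carrier := {v | ∀ g ∈ Q, Matrix.toEuclideanLin (g : Op d N) v = v}
  zero_mem' := fun _ _ => map_zero _
  add_mem' := fun hv hw g hg => by rw [map_add, hv g hg, hw g hg]
  smul_mem' := fun c v hv g hg => by rw [map_smul, hv g hg]

/-- The rank-one operator `|φ⟩⟨φ|`. -/
def ketBra (φ : Hilb d N) : Op d N := Matrix.vecMulVec φ.ofLp (star φ.ofLp)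

/-- The pure-state density operators whose support (range) lies in `Span{ψ} ⊕ S_Q^⊥`. -/
def pureStates (ψ : Hilb d N) (Q : Subgroup (Matrix.unitaryGroup (Label d N) ℂ)) :
    Set (Op d N) :=
  {ρ | (∃ φ : Hilb d N, ‖φ‖ = 1 ∧ ρ = ketBra φ) ∧
    LinearMap.range (Matrix.toEuclideanLin ρ) ≤
      Submodule.span ℂ {ψ} ⊔ (stabilizedSpace Q)ᗮ}

/-! ### Magic measures -/

/-- The symplectic form `⟨(p,q),(p',q')⟩ = p · q' - q · p'`. -/
def symp (x y : Phase d N) : ZMod d := x.1 ⬝ᵥ y.2 - x.2 ⬝ᵥ y.1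

/-- The displacement operator `T_{(p,q)} = τ^{p·q} X^p Z^q`, `τ = ω^{1/2}` with `1/2` taken
in `ℤ_d` (used for odd `d` only). -/
def displacement (x : Phase d N) : Op d N :=
  omegaPow ((2 : ZMod d)⁻¹ * (x.1 ⬝ᵥ x.2)) • pauliOp x.1 x.2

/-- The phase point operator `A_x = d^{-N} ∑_y ω^{-⟨x,y⟩} T_y`. -/
def phasePoint (x : Phase d N) : Op d N :=
  ((d : ℂ) ^ N)⁻¹ • ∑ y : Phase d N, omegaPow (-symp x y) • displacement y

/-- The discrete Wigner function `W_x(O) = d^{-N} Tr (O A_x)` (real when `O` is Hermitian). -/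
def wigner (O : Op d N) (x : Phase d N) : ℂ := ((d : ℂ) ^ N)⁻¹ * (O * phasePoint x).trace

/-- The mana of magic `log ∑_x |W_x(ρ)|` (for odd `d`). -/
def mana (ρ : Op d N) : ℝ := Real.log (∑ x : Phase d N, ‖wigner ρ x‖)

/-- `P_x(ρ) = d^{-N} |Tr (ρ X^p Z^q)|^2` for `x = (p, q)`. The phase points `x` label the Pauli
operators modulo phases, and the value does not depend on the phase of the representative. -/
def pauliProb (ρ : Op d N) (x : Phase d N) : ℝ :=
  ((d : ℝ) ^ N)⁻¹ * ‖(ρ * pauliOp x.1 x.2).trace‖ ^ 2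

/-- The stabilizer `α`-Rényi entropy
`(1 - α)⁻¹ log (d^{-(1-α)N} ∑_x P_x(ρ)^α)` of a pure state `ρ`. -/
def stabilizerRenyi (α : ℝ) (ρ : Op d N) : ℝ :=
  (1 - α)⁻¹ * Real.log
    (((d : ℝ) ^ ((1 - α) * (N : ℝ)))⁻¹ * ∑ x : Phase d N, pauliProb ρ x ^ α)

/-- Pure stabilizer states: normalized vectors fixed by an Abelian subgroup of order `d^N` of the
Pauli group. -/
def stabilizerStates (d N : ℕ) [Fact d.Prime] : Set (Hilb d N) :=
  {s | ‖s‖ = 1 ∧ ∃ S : Subgroup (Matrix.unitaryGroup (Label d N) ℂ),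
    S ≤ pauliGroup d N ∧ (∀ g ∈ S, ∀ h ∈ S, g * h = h * g) ∧ Nat.card S = d ^ N ∧
      s ∈ stabilizedSpace S}

/-- The stabilizer fidelity `max_s |⟨s|ρ|s⟩|` over the stabilizer states `s` (there are finitely
many of them up to phase, so the supremum is a maximum). -/
def stabilizerFidelity (ρ : Op d N) : ℝ :=
  sSup ((fun s : Hilb d N => ‖inner ℂ s (Matrix.toEuclideanLin ρ s)‖) '' stabilizerStates d N)

end

/-! ### Extremal points -/

/-- Extremal point of a continuous function of one real variable: a zero of the derivative, a local
minimum, a local maximum, or a point near which the function is constant. -/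
def IsExtremalPoint (f : ℝ → ℝ) (x : ℝ) : Prop :=
  Continuous f ∧
    (HasDerivAt f 0 x ∨
      (∃ ε > 0, ∀ y ∈ Set.Ioo (x - ε) (x + ε), f x ≤ f y) ∨
      (∃ ε > 0, ∀ y ∈ Set.Ioo (x - ε) (x + ε), f y ≤ f x) ∨
      (∃ ε > 0, ∀ y ∈ Set.Ioo (x - ε) (x + ε), f y = f x))

/-- `ρ₀` is an extremal point of `f` restricted to `M`: it lies in `M`, and along every smooth curve
in `M` through `ρ₀` the function `f` has an extremal point at `ρ₀`. -/
def IsExtremalOn {d N : ℕ} (f : Op d N → ℝ) (M : Set (Op d N)) (ρ₀ : Op d N) : Prop :=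
  ρ₀ ∈ M ∧ ∀ γ : ℝ → Op d N, (∀ i j, ContDiff ℝ ∞ fun t => γ t i j) → (∀ t, γ t ∈ M) →
    γ 0 = ρ₀ → IsExtremalPoint (fun t => f (γ t)) 0

end QuditMagic

end

open scoped Topology

set_option linter.unusedSectionVars false

namespace QuditMagic

/-! ### Functions of one real variable that are flat or have an upward cusp at `0` -/

/-! All three measures are built from numbers `Tr (ρ E)`, where `E` runs over a finite family that
the Clifford group permutes up to phases: Pauli operators, phase point operators, or projectors onto
stabilizer states. Let `D` be the velocity at `ψ` of a curve of admissible pure states. The heart of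
the proof is `sum_conj_deriv_eq_zero`: the twirl `∑ g† D g` over `Q` is zero. Indeed `D = Dψ + ψD`
because the curve consists of projectors, and `g` fixes `ψ`, so the twirl is `R D ψ + ψ D R` with `R
= ∑ g`. Now `R` is `|Q|` times the projector onto the stabilized space, and the support condition
makes it act on the curve as `|Q| ψ`; hence `R D ψ = |Q| ψ D ψ = 0`. Consequently the derivatives of
`Tr (ρ E)` sum to zero along each `Q`-orbit of operators, while the values at `ψ` agree along the
orbit, up to phases.

For the mana and the Rényi entropy, the first-order terms of `∑ |Tr (ρ E)|^b` at nonzero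
expectations therefore cancel. An expectation vanishing at `ψ` contributes `|g|^b` with `g` smooth
and `g 0 = 0`, which is either flat or has an upward cusp. Cusps all point the same way and cannot
cancel, so the sum has zero derivative or a minimum (`cuspOrFlat_sum_norm_trace_rpow`); a multiple
of the logarithm preserves extremality.

For the fidelity, a finite maximum of smooth functions, the derivatives along an orbit of maximizers
either all vanish or take both signs. When all maximizers have zero derivative, so does the maximum;
otherwise it has a local minimum (`isExtremalPoint_sup'`). -/

/-- Either the derivative at `0` exists and vanishes, or `f` grows at least linearly away
from `0`. -/
def CuspOrFlat (f : ℝ → ℝ) : Prop :=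
  HasDerivAt f 0 0 ∨ ∃ c > 0, ∀ᶠ t in 𝓝 (0 : ℝ), c * |t| ≤ f t - f 0

lemma hasDerivAt_zero_iff_isLittleO (f : ℝ → ℝ) :
    HasDerivAt f 0 0 ↔ (fun t => f t - f 0) =o[𝓝 0] fun t : ℝ => t := by
  rw [hasDerivAt_iff_isLittleO]
  simp

lemma CuspOrFlat.add_flat {f g : ℝ → ℝ} {c : ℝ} (hc : 0 < c)
    (hf : ∀ᶠ t in 𝓝 (0 : ℝ), c * |t| ≤ f t - f 0) (hg : HasDerivAt g 0 0) :
    ∀ᶠ t in 𝓝 (0 : ℝ), c / 2 * |t| ≤ (f t + g t) - (f 0 + g 0) := by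
  rw [hasDerivAt_zero_iff_isLittleO] at hg
  filter_upwards [hf, hg.def (half_pos hc)] with t h1 h2
  rw [Real.norm_eq_abs, Real.norm_eq_abs] at h2
  linarith [(abs_le.1 h2).1]

/-- Linear growth dominates the `o(t)` of a flat summand. A mere local minimum would not suffice:
`max 0 t - t ^ 2` is not extremal at `0`. -/
lemma CuspOrFlat.add {f g : ℝ → ℝ} (hf : CuspOrFlat f) (hg : CuspOrFlat g) :
    CuspOrFlat fun t => f t + g t := by
  rcases hf with hf | ⟨c, hc, hf⟩ <;> rcases hg with hg | ⟨c', hc', hg⟩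
  · left
    simpa using hf.fun_add hg
  · refine Or.inr ⟨c' / 2, half_pos hc', ?_⟩
    filter_upwards [CuspOrFlat.add_flat hc' hg hf] with t ht
    linarith
  · exact Or.inr ⟨c / 2, half_pos hc, CuspOrFlat.add_flat hc hf hg⟩
  · refine Or.inr ⟨c + c', add_pos hc hc', ?_⟩
    filter_upwards [hf, hg] with t h1 h2
    linarith

lemma CuspOrFlat.sum {ι : Type*} (s : Finset ι) {f : ι → ℝ → ℝ}
    (hf : ∀ i ∈ s, CuspOrFlat (f i)) : CuspOrFlat fun t => ∑ i ∈ s, f i t := by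
  classical
  induction s using Finset.induction_on with
  | empty => exact Or.inl (by simpa using hasDerivAt_const (0 : ℝ) (0 : ℝ))
  | insert a s ha ih =>
    simp only [Finset.sum_insert ha]
    exact (hf a (by simp)).add (ih fun i hi => hf i (by simp [hi]))

lemma CuspOrFlat.const_mul {f : ℝ → ℝ} (hf : CuspOrFlat f) {k : ℝ} (hk : 0 < k) :
    CuspOrFlat fun t => k * f t := by
  rcases hf with hf | ⟨c, hc, hf⟩
  · left
    simpa using hf.const_mul k
  · refine Or.inr ⟨k * c, mul_pos hk hc, ?_⟩
    filter_upwards [hf] with t ht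
    nlinarith

lemma CuspOrFlat.isExtremalPoint {f : ℝ → ℝ} (hf : CuspOrFlat f) (hcont : Continuous f) :
    IsExtremalPoint f 0 := by
  refine ⟨hcont, ?_⟩
  rcases hf with hf | ⟨c, hc, hf⟩
  · exact Or.inl hf
  · right; left
    obtain ⟨ε, hε, h⟩ := Metric.eventually_nhds_iff.1 hf
    refine ⟨ε, hε, fun y hy => ?_⟩
    have := h (y := y) (by rw [Real.dist_eq, abs_lt]; constructor <;> linarith [hy.1, hy.2])
    nlinarith [abs_nonneg y]

/-- The logarithm is monotone, and a negative factor `a`, as in the Rényi prefactor for `α > 1`,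
turns the minimum into a maximum. -/
lemma CuspOrFlat.isExtremalPoint_mul_log {f : ℝ → ℝ} (hf : CuspOrFlat f) (hcont : Continuous f)
    (hpos : ∀ t, 0 < f t) (a : ℝ) : IsExtremalPoint (fun t => a * Real.log (f t)) 0 := by
  refine ⟨continuous_const.mul (hcont.log fun t => (hpos t).ne'), ?_⟩
  rcases hf with hd | hc
  · left
    simpa using (hd.log (hpos 0).ne').const_mul a
  · obtain ⟨-, hd | ⟨ε, hε, h⟩ | ⟨ε, hε, h⟩ | ⟨ε, hε, h⟩⟩ :=
      CuspOrFlat.isExtremalPoint (Or.inr hc) hcont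
    · left
      simpa using (hd.log (hpos 0).ne').const_mul a
    · have hl : ∀ y ∈ Set.Ioo (0 - ε) (0 + ε), Real.log (f 0) ≤ Real.log (f y) :=
        fun y hy => Real.log_le_log (hpos 0) (h y hy)
      rcases le_total 0 a with ha | ha
      · exact Or.inr (Or.inl ⟨ε, hε, fun y hy => mul_le_mul_of_nonneg_left (hl y hy) ha⟩)
      · exact Or.inr (Or.inr (Or.inl
          ⟨ε, hε, fun y hy => mul_le_mul_of_nonpos_left (hl y hy) ha⟩))
    · have hl : ∀ y ∈ Set.Ioo (0 - ε) (0 + ε), Real.log (f y) ≤ Real.log (f 0) :=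
        fun y hy => Real.log_le_log (hpos y) (h y hy)
      rcases le_total 0 a with ha | ha
      · exact Or.inr (Or.inr (Or.inl
          ⟨ε, hε, fun y hy => mul_le_mul_of_nonneg_left (hl y hy) ha⟩))
      · exact Or.inr (Or.inl ⟨ε, hε, fun y hy => mul_le_mul_of_nonpos_left (hl y hy) ha⟩)
    · exact Or.inr (Or.inr (Or.inr ⟨ε, hε, fun y hy => by simp only [h y hy]⟩))

/-- Leading-order behaviour at `0` of a smooth function. -/
lemma ContDiff.leading_term {g : ℝ → ℂ} (hg : ContDiff ℝ ∞ g) (n : ℕ) :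
    g =o[𝓝 0] (fun t : ℝ => t ^ n) ∨
      ∃ (k : ℕ) (c : ℂ), c ≠ 0 ∧ (fun t : ℝ => g t - (t ^ k) • c) =o[𝓝 0] fun t : ℝ => t ^ k := by
  have taylor (m : ℕ) := taylor_isLittleO_univ (x₀ := 0)
    (hg.of_le (m := m) (by exact_mod_cast le_top))
  simp only [taylor_within_apply, sub_zero] at taylor
  by_cases h : ∃ k, iteratedDerivWithin k g Set.univ 0 ≠ 0
  · right
    classical
    -- At the first order with a nonvanishing derivative, the Taylor polynomial is a single
    -- monomial.
    refine ⟨Nat.find h, ((Nat.find h).factorial : ℝ)⁻¹ •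
      iteratedDerivWithin (Nat.find h) g Set.univ 0,
      smul_ne_zero (by positivity) (Nat.find_spec h), ?_⟩
    have := taylor (Nat.find h)
    refine this.congr_left fun t => ?_
    rw [Finset.sum_range_succ, Finset.sum_eq_zero, zero_add, smul_smul, mul_comm]
    intro k hk
    have := Nat.find_min h (Finset.mem_range.1 hk)
    rw [not_not.1 this, smul_zero]
  · push Not at h
    left
    simpa [h] using taylor n

lemma isLittleO_abs_rpow {p : ℝ} (hp : 1 < p) :
    (fun t : ℝ => |t| ^ p) =o[𝓝 0] fun t : ℝ => t := by
  have h : Filter.Tendsto (fun t : ℝ => |t| ^ (p - 1)) (𝓝 0) (𝓝 0) := by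
    have hc : Continuous fun t : ℝ => |t| ^ (p - 1) :=
      continuous_abs.rpow_const fun _ => Or.inr (by linarith)
    simpa [Real.zero_rpow (sub_pos.2 hp).ne'] using hc.tendsto 0
  refine (Asymptotics.isLittleO_iff_exists_eq_mul.2
    ⟨fun t => |t| ^ (p - 1), h, .of_forall fun t => ?_⟩ :
      _ =o[𝓝 0] fun t : ℝ => |t|).trans_isBigO (Asymptotics.isBigO_refl _ _).abs_left
  simp only [Pi.mul_apply]
  rcases eq_or_ne t 0 with rfl | ht
  · simp [Real.zero_rpow (by linarith : p ≠ 0)]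
  · rw [← Real.rpow_add_one (abs_pos.2 ht).ne']
    simp

/-- If `g` has leading order `t ^ k`, then `‖g‖ ^ b` is of size `|t| ^ (k * b)`: flat for `k * b >
1`, a cusp for `k * b ≤ 1`. Since `b` may be small, derivatives of arbitrarily high order matter. -/
lemma cuspOrFlat_norm_rpow_of_zero {g : ℝ → ℂ} (hg : ContDiff ℝ ∞ g) (h0 : g 0 = 0) {b : ℝ}
    (hb : 0 < b) : CuspOrFlat fun t => ‖g t‖ ^ b := by
  have flat (k : ℕ) (hk : 1 < k * b) (h : g =O[𝓝 0] fun t : ℝ => t ^ k) :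
      CuspOrFlat fun t => ‖g t‖ ^ b := by
    left
    rw [hasDerivAt_zero_iff_isLittleO]
    simp only [h0, norm_zero, Real.zero_rpow hb.ne', sub_zero]
    refine Asymptotics.IsBigO.trans_isLittleO ?_ (isLittleO_abs_rpow hk)
    have := h.norm_norm.rpow hb.le (.of_forall fun t => norm_nonneg _)
    refine this.congr_right fun t => ?_
    rw [norm_pow, Real.norm_eq_abs, ← Real.rpow_natCast, ← Real.rpow_mul (abs_nonneg t)]
  -- With `n * b > 1`, a bound `g = o(t ^ n)` already forces flatness; this covers `g` with all
  -- derivatives zero.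
  obtain ⟨n, hn⟩ := exists_nat_gt (1 / b)
  rw [div_lt_iff₀ hb] at hn
  rcases ContDiff.leading_term hg n with h | ⟨k, c, hc, h⟩
  · exact flat n hn h.isBigO
  · rcases lt_or_ge 1 (k * b) with hk | hk
    · refine flat k hk ?_
      have h1 : (fun t : ℝ => (t ^ k) • c) =O[𝓝 0] fun t : ℝ => t ^ k :=
        Asymptotics.IsBigO.of_bound ‖c‖ (.of_forall fun t => by rw [norm_smul, mul_comm])
      simpa using h.isBigO.add h1
    · right
      have hc' : 0 < ‖c‖ / 2 := half_pos (norm_pos_iff.2 hc)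
      refine ⟨(‖c‖ / 2) ^ b, Real.rpow_pos_of_pos hc' b, ?_⟩
      filter_upwards [h.def hc', Metric.ball_mem_nhds (0 : ℝ) one_pos] with t ht ht1
      rw [mem_ball_zero_iff, Real.norm_eq_abs] at ht1
      simp only [h0, norm_zero, Real.zero_rpow hb.ne', sub_zero]
      rcases eq_or_ne t 0 with rfl | htne
      · simp [h0, Real.zero_rpow hb.ne']
      have h2 : ‖c‖ / 2 * |t| ^ k ≤ ‖g t‖ := by
        have h3 := norm_sub_norm_le ((t ^ k) • c) (g t)
        rw [norm_sub_rev] at h3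
        rw [norm_smul, norm_pow, Real.norm_eq_abs] at h3
        rw [norm_pow, Real.norm_eq_abs] at ht
        linarith
      calc (‖c‖ / 2) ^ b * |t| ≤ (‖c‖ / 2) ^ b * |t| ^ (k * b) := by
            gcongr
            calc |t| = |t| ^ (1 : ℝ) := (Real.rpow_one _).symm
              _ ≤ _ := Real.rpow_le_rpow_of_exponent_ge (abs_pos.2 htne) ht1.le hk
        _ = (‖c‖ / 2 * |t| ^ k) ^ b := by
            rw [Real.mul_rpow hc'.le (by positivity), ← Real.rpow_natCast,
              ← Real.rpow_mul (abs_nonneg t)]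
        _ ≤ ‖g t‖ ^ b := Real.rpow_le_rpow (by positivity) h2 hb.le

/-- The power is taken of the smooth function `‖g‖ ^ 2`, with exponent `b / 2`. -/
lemma hasDerivAt_norm_rpow {g : ℝ → ℂ} {g' : ℂ} (hg : HasDerivAt g g' 0) (h0 : g 0 ≠ 0) (b : ℝ) :
    HasDerivAt (fun t => ‖g t‖ ^ b) (b * ((‖g 0‖ ^ 2) ^ (b / 2 - 1) * inner ℝ (g 0) g')) 0 := by
  have h := hg.norm_sq.rpow_const (p := b / 2) (Or.inl (by positivity))
  refine (h.congr_deriv ?_).congr_of_eventuallyEq (.of_forall fun t => ?_)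
  · ring
  · change _ = (‖g t‖ ^ 2) ^ (b / 2)
    rw [← Real.rpow_natCast, ← Real.rpow_mul (norm_nonneg _)]
    rw [show ((2 : ℕ) : ℝ) * (b / 2) = b by push_cast; ring]

/-- A sum of powers of norms of smooth functions is flat or has a cusp at `0` as soon as the
derivatives of the differentiable summands cancel. -/
lemma cuspOrFlat_sum_norm_rpow {ι : Type*} [Fintype ι] {g : ι → ℝ → ℂ}
    (hg : ∀ i, ContDiff ℝ ∞ (g i)) {b : ℝ} (hb : 0 < b)
    (h : ∑ i, (‖g i 0‖ ^ 2) ^ (b / 2 - 1) * inner ℝ (g i 0) (deriv (g i) 0) = 0) :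
    CuspOrFlat fun t => ∑ i, ‖g i t‖ ^ b := by
  let k (i : ι) : ℝ := b * ((‖g i 0‖ ^ 2) ^ (b / 2 - 1) * inner ℝ (g i 0) (deriv (g i) 0))
  -- Removing its linear part makes each summand flat or cusped, and the removed parts add up to
  -- zero. Where `g i 0 = 0` the inner product makes `k i` vanish.
  have key (i : ι) : CuspOrFlat fun t => ‖g i t‖ ^ b - t * k i := by
    by_cases h0 : g i 0 = 0
    · simpa [k, h0] using cuspOrFlat_norm_rpow_of_zero (hg i) h0 hb
    · left
      have hd := ((hg i).differentiable (by simp) 0).hasDerivAt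
      have := (hasDerivAt_norm_rpow hd h0 b).sub ((hasDerivAt_id (0 : ℝ)).mul_const (k i))
      refine this.congr_deriv ?_
      simp [k]
  have := CuspOrFlat.sum Finset.univ fun i _ => key i
  have hk : ∑ i, k i = 0 := by rw [← Finset.mul_sum, h, mul_zero]
  simpa [Finset.sum_sub_distrib, ← Finset.mul_sum, hk] using this

/-- The pointwise maximum of finitely many differentiable functions is flat or has a minimum at
`0`, if the derivatives of those attaining the maximum at `0` do not all have the same sign. -/
lemma isExtremalPoint_sup' {ι : Type*} (s : Finset ι) (hs : s.Nonempty) {h : ι → ℝ → ℝ}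
    (hcont : ∀ i ∈ s, Continuous (h i)) (hd : ∀ i ∈ s, DifferentiableAt ℝ (h i) 0)
    (hmax : ∀ i ∈ s, (∀ j ∈ s, h j 0 ≤ h i 0) → deriv (h i) 0 ≠ 0 →
      (∃ j ∈ s, h j 0 = h i 0 ∧ 0 < deriv (h j) 0) ∧
      (∃ j ∈ s, h j 0 = h i 0 ∧ deriv (h j) 0 < 0)) :
    IsExtremalPoint (fun t => s.sup' hs fun i => h i t) 0 := by
  refine ⟨Continuous.finset_sup'_apply hs hcont, ?_⟩
  set F : ℝ → ℝ := fun t => s.sup' hs fun i => h i t with hF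
  have le (i) (hi : i ∈ s) (t : ℝ) : h i t ≤ F t := Finset.le_sup' (fun i => h i t) hi
  obtain ⟨i₀, hi₀, hF0⟩ := Finset.exists_mem_eq_sup' hs fun i => h i 0
  change F 0 = h i₀ 0 at hF0
  have lo (i) (hi : i ∈ s) := (hasDerivAt_iff_isLittleO.1 (hd i hi).hasDerivAt)
  simp only [sub_zero, smul_eq_mul] at lo
  by_cases hall : ∀ i ∈ s, h i 0 = F 0 → deriv (h i) 0 = 0
  · left
    rw [hasDerivAt_zero_iff_isLittleO, Asymptotics.isLittleO_iff]
    intro c hc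
    have up : ∀ᶠ t in 𝓝 (0 : ℝ), ∀ i ∈ s, h i t ≤ F 0 + c * ‖t‖ := by
      rw [Filter.eventually_all_finset]
      intro i hi
      -- Maximizers at `0` are flat; by continuity the others stay below the maximum near `0`.
      rcases (le i hi 0).eq_or_lt with he | hlt
      · filter_upwards [(lo i hi).def hc] with t ht
        rw [hall i hi he, mul_zero, sub_zero] at ht
        linarith [(abs_le.1 ht).2]
      · filter_upwards [(hcont i hi).continuousAt.eventually_lt_const hlt] with t ht
        have : 0 ≤ c * ‖t‖ := by positivity
        linarith
    filter_upwards [up, (lo i₀ hi₀).def hc] with t h1 h2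
    rw [hall i₀ hi₀ hF0.symm, mul_zero, sub_zero] at h2
    rw [Real.norm_eq_abs, abs_le]
    have h3 : F t ≤ F 0 + c * ‖t‖ := Finset.sup'_le hs _ h1
    constructor
    · linarith [(abs_le.1 h2).1, le i₀ hi₀ t]
    · linarith
  · right; left
    push Not at hall
    obtain ⟨i, hi, he, hne⟩ := hall
    obtain ⟨⟨j, hj, hj0, hjd⟩, ⟨k, hk, hk0, hkd⟩⟩ :=
      hmax i hi (fun j hj => he ▸ le j hj 0) hne
    -- Taking the slope itself as error tolerance gives `h j t ≥ h j 0` for small `t ≥ 0`; the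
    -- negative slope of `h k` does the same for `t ≤ 0`.
    have h1 := (lo j hj).def hjd
    have h2 := (lo k hk).def (neg_pos.2 hkd)
    obtain ⟨ε, hε, h⟩ := Metric.eventually_nhds_iff.1 (h1.and h2)
    refine ⟨ε, hε, fun y hy => ?_⟩
    obtain ⟨hy1, hy2⟩ :=
      h (y := y) (by rw [Real.dist_eq, abs_lt]; constructor <;> linarith [hy.1, hy.2])
    rw [Real.norm_eq_abs, Real.norm_eq_abs] at hy1 hy2
    rcases le_total 0 y with h0 | h0
    · rw [abs_of_nonneg h0] at hy1
      have := (abs_le.1 hy1).1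
      have := le j hj y
      linarith
    · rw [abs_of_nonpos h0] at hy2
      have := (abs_le.1 hy2).1
      have := le k hk y
      linarith

/-! ### Entrywise derivatives of curves of matrices -/

/-- Entrywise derivative at `0` of a curve of operators. -/
def HasEntryDeriv {m n : Type*} (γ : ℝ → Matrix m n ℂ) (D : Matrix m n ℂ) : Prop :=
  ∀ i j, HasDerivAt (fun t => γ t i j) (D i j) 0

lemma HasEntryDeriv.unique {m n : Type*} {γ : ℝ → Matrix m n ℂ} {D D' : Matrix m n ℂ}
    (h : HasEntryDeriv γ D) (h' : HasEntryDeriv γ D') : D = D' := by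
  ext i j
  exact (h i j).unique (h' i j)

lemma hasEntryDeriv_const {m n : Type*} (A : Matrix m n ℂ) : HasEntryDeriv (fun _ => A) 0 :=
  fun _ _ => hasDerivAt_const _ _

lemma HasEntryDeriv.mul {l m n : Type*} [Fintype m] {γ : ℝ → Matrix l m ℂ} {δ : ℝ → Matrix m n ℂ}
    {D : Matrix l m ℂ} {E : Matrix m n ℂ} (h : HasEntryDeriv γ D) (h' : HasEntryDeriv δ E) :
    HasEntryDeriv (fun t => γ t * δ t) (D * δ 0 + γ 0 * E) := by
  intro i j
  have := HasDerivAt.fun_sum fun k (_ : k ∈ Finset.univ) => (h i k).fun_mul (h' k j)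
  simpa [Matrix.mul_apply, Finset.sum_add_distrib] using this

lemma HasEntryDeriv.conjTranspose {m n : Type*} {γ : ℝ → Matrix m n ℂ} {D : Matrix m n ℂ}
    (h : HasEntryDeriv γ D) : HasEntryDeriv (fun t => (γ t)ᴴ) Dᴴ :=
  fun i j => (h j i).star

lemma HasEntryDeriv.trace {m : Type*} [Fintype m] {γ : ℝ → Matrix m m ℂ} {D : Matrix m m ℂ}
    (h : HasEntryDeriv γ D) : HasDerivAt (fun t => (γ t).trace) D.trace 0 :=
  HasDerivAt.fun_sum fun k (_ : k ∈ Finset.univ) => h k k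

lemma contDiff_trace_mul {m : Type*} [Fintype m] {γ : ℝ → Matrix m m ℂ}
    (h : ∀ i j, ContDiff ℝ ∞ fun t => γ t i j) (E : Matrix m m ℂ) :
    ContDiff ℝ ∞ fun t => (γ t * E).trace := by
  simp only [Matrix.trace, Matrix.diag_apply, Matrix.mul_apply]
  exact ContDiff.sum fun i _ => ContDiff.sum fun j _ => (h i j).mul contDiff_const

section

variable {d N : ℕ} [Fact d.Prime]

/-! ### Pure states -/

lemma star_dotProduct_self_of_norm_eq_one {φ : Hilb d N} (h : ‖φ‖ = 1) :
    star φ.ofLp ⬝ᵥ φ.ofLp = 1 := by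
  rw [dotProduct_comm, ← EuclideanSpace.inner_eq_star_dotProduct, inner_self_eq_norm_sq_to_K, h]
  simp

lemma conjTranspose_ketBra (φ : Hilb d N) : (ketBra φ)ᴴ = ketBra φ := by
  simp [ketBra, Matrix.conjTranspose_vecMulVec]

lemma ketBra_mul_self {φ : Hilb d N} (h : ‖φ‖ = 1) : ketBra φ * ketBra φ = ketBra φ := by
  simp [ketBra, Matrix.vecMulVec_mul_vecMulVec, star_dotProduct_self_of_norm_eq_one h]

lemma trace_ketBra {φ : Hilb d N} (h : ‖φ‖ = 1) : (ketBra φ).trace = 1 := by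
  rw [ketBra, Matrix.trace_vecMulVec, dotProduct_comm, star_dotProduct_self_of_norm_eq_one h]

lemma mul_ketBra (A : Op d N) (φ : Hilb d N) :
    A * ketBra φ = Matrix.vecMulVec (Matrix.toEuclideanLin A φ).ofLp (star φ.ofLp) := by
  rw [ketBra, Matrix.mul_vecMulVec]
  rfl

lemma toEuclideanLin_ketBra (φ x : Hilb d N) :
    Matrix.toEuclideanLin (ketBra φ) x = inner ℂ φ x • φ := by
  ext i
  simp [ketBra, Matrix.toLpLin_apply, Matrix.vecMulVec_mulVec,
    EuclideanSpace.inner_eq_star_dotProduct,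
    dotProduct_comm, mul_comm]

lemma inner_toEuclideanLin (A : Op d N) (φ : Hilb d N) :
    inner ℂ φ (Matrix.toEuclideanLin A φ) = (A * ketBra φ).trace := by
  rw [mul_ketBra, Matrix.trace_vecMulVec, EuclideanSpace.inner_eq_star_dotProduct]

variable {Q : Subgroup (Matrix.unitaryGroup (Label d N) ℂ)} {ψ : Hilb d N}

lemma conjTranspose_mul_unitary (g : Matrix.unitaryGroup (Label d N) ℂ) :
    (g : Op d N)ᴴ * (g : Op d N) = 1 := Unitary.star_mul_self_of_mem g.2

lemma mul_ketBra_of_mem (hψ : ψ ∈ stabilizedSpace Q)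
    {g : Matrix.unitaryGroup (Label d N) ℂ} (hg : g ∈ Q) :
    (g : Op d N) * ketBra ψ = ketBra ψ := by
  rw [mul_ketBra, hψ g hg, ketBra]

lemma ketBra_mul_of_mem (hψ : ψ ∈ stabilizedSpace Q)
    {g : Matrix.unitaryGroup (Label d N) ℂ} (hg : g ∈ Q) :
    ketBra ψ * (g : Op d N) = ketBra ψ := by
  have h : ((g⁻¹ : Matrix.unitaryGroup (Label d N) ℂ) : Op d N) * ketBra ψ = ketBra ψ :=
    mul_ketBra_of_mem hψ (Q.inv_mem hg)
  have := congrArg Matrix.conjTranspose h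
  rw [Matrix.conjTranspose_mul, conjTranspose_ketBra, Matrix.UnitaryGroup.inv_val,
    Matrix.star_eq_conjTranspose, Matrix.conjTranspose_conjTranspose] at this
  exact this

lemma conjTranspose_mul_ketBra_of_mem (hψ : ψ ∈ stabilizedSpace Q)
    {g : Matrix.unitaryGroup (Label d N) ℂ} (hg : g ∈ Q) :
    (g : Op d N)ᴴ * ketBra ψ = ketBra ψ := by
  have := congrArg Matrix.conjTranspose (ketBra_mul_of_mem hψ hg)
  rwa [Matrix.conjTranspose_mul, conjTranspose_ketBra] at this

/-! ### The sum over the group -/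

section

variable [Fintype Q]

variable (Q) in
/-- The sum of all elements of `Q`. -/
def groupSum : Op d N := ∑ g : Q, (g : Matrix.unitaryGroup (Label d N) ℂ).1

/-- Inversion permutes `Q` and is the adjoint on unitaries. With `groupSum_mul_self`, `groupSum Q`
is thus `|Q|` times an orthogonal projector, namely the one onto the stabilized space. -/
lemma conjTranspose_groupSum : (groupSum Q)ᴴ = groupSum Q := by
  rw [groupSum, Matrix.conjTranspose_sum]
  exact Fintype.sum_equiv (Equiv.inv Q) _ _ fun g => rfl

lemma mul_groupSum {g : Matrix.unitaryGroup (Label d N) ℂ} (hg : g ∈ Q) :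
    (g : Op d N) * groupSum Q = groupSum Q := by
  rw [groupSum, Finset.mul_sum]
  exact Fintype.sum_equiv (Equiv.mulLeft (⟨g, hg⟩ : Q)) _ _ fun g => rfl

lemma groupSum_mul_self : groupSum Q * groupSum Q = (Fintype.card Q : ℂ) • groupSum Q := by
  nth_rw 1 [groupSum]
  rw [Finset.sum_mul, Finset.sum_congr rfl fun (g : Q) _ => mul_groupSum g.2]
  simp [Nat.cast_smul_eq_nsmul]

lemma groupSum_mul_ketBra (hψ : ψ ∈ stabilizedSpace Q) :
    groupSum Q * ketBra ψ = (Fintype.card Q : ℂ) • ketBra ψ := by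
  rw [groupSum, Finset.sum_mul, Finset.sum_congr rfl fun (g : Q) _ => mul_ketBra_of_mem hψ g.2]
  simp [Nat.cast_smul_eq_nsmul]

lemma toEuclideanLin_mul_apply (A B : Op d N) (x : Hilb d N) :
    Matrix.toEuclideanLin (A * B) x = Matrix.toEuclideanLin A (Matrix.toEuclideanLin B x) := by
  ext i
  simp [Matrix.toLpLin_apply]

lemma toEuclideanLin_groupSum_mem (x : Hilb d N) :
    Matrix.toEuclideanLin (groupSum Q) x ∈ stabilizedSpace Q := by
  intro g hg
  rw [← toEuclideanLin_mul_apply, mul_groupSum hg]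

lemma toEuclideanLin_groupSum_of_mem {x : Hilb d N} (hx : x ∈ stabilizedSpace Q) :
    Matrix.toEuclideanLin (groupSum Q) x = (Fintype.card Q : ℂ) • x := by
  rw [groupSum, map_sum, LinearMap.sum_apply, Finset.sum_congr rfl fun (g : Q) _ => hx g g.2]
  simp [Nat.cast_smul_eq_nsmul]

lemma toEuclideanLin_groupSum_of_mem_orthogonal {x : Hilb d N} (hx : x ∈ (stabilizedSpace Q)ᗮ) :
    Matrix.toEuclideanLin (groupSum Q) x = 0 := by
  rw [← inner_self_eq_zero (𝕜 := ℂ), ← LinearMap.adjoint_inner_left,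
    ← Matrix.toEuclideanLin_conjTranspose_eq_adjoint, conjTranspose_groupSum]
  exact Submodule.inner_right_of_mem_orthogonal (toEuclideanLin_groupSum_mem _) hx

/-! ### Averages of tangent vectors -/

/-- The two operators agree on `Span {ψ} ⊕ S_Q^⊥`, which contains the range of `ρ`. This is where
the support condition on the curve enters. -/
lemma groupSum_mul_of_mem_pureStates (hψ : ψ ∈ stabilizedSpace Q) (hnorm : ‖ψ‖ = 1)
    {ρ : Op d N} (hρ : ρ ∈ pureStates ψ Q) :
    groupSum Q * ρ = (Fintype.card Q : ℂ) • ketBra ψ * ρ := by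
  have hker : Submodule.span ℂ {ψ} ⊔ (stabilizedSpace Q)ᗮ ≤
      LinearMap.ker (Matrix.toEuclideanLin (groupSum Q - (Fintype.card Q : ℂ) • ketBra ψ)) := by
    rw [sup_le_iff, Submodule.span_singleton_le_iff_mem]
    refine ⟨?_, fun x hx => ?_⟩ <;>
      rw [LinearMap.mem_ker, map_sub, map_smul, LinearMap.sub_apply, LinearMap.smul_apply,
        toEuclideanLin_ketBra]
    · rw [toEuclideanLin_groupSum_of_mem hψ, inner_self_eq_norm_sq_to_K, hnorm]
      simp
    · rw [toEuclideanLin_groupSum_of_mem_orthogonal hx,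
        Submodule.inner_right_of_mem_orthogonal hψ hx]
      simp
  rw [← sub_eq_zero, ← sub_mul]
  apply Matrix.toEuclideanLin.injective
  ext1 x
  rw [toEuclideanLin_mul_apply, map_zero, LinearMap.zero_apply]
  exact hker (hρ.2 ⟨x, rfl⟩)

lemma ketBra_mem_pureStates (hnorm : ‖ψ‖ = 1) : ketBra ψ ∈ pureStates ψ Q := by
  refine ⟨⟨ψ, hnorm, rfl⟩, ?_⟩
  rintro _ ⟨x, rfl⟩
  rw [toEuclideanLin_ketBra]
  exact Submodule.smul_mem _ _ (Submodule.mem_sup_left (Submodule.mem_span_singleton_self ψ))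

/-- The average over `Q` of a tangent vector at `ketBra ψ` to the set of pure states supported in
`Span {ψ} ⊕ S_Q^⊥` vanishes. -/
lemma sum_conj_deriv_eq_zero (hψ : ψ ∈ stabilizedSpace Q) (hnorm : ‖ψ‖ = 1)
    {γ : ℝ → Op d N} {D : Op d N} (hD : HasEntryDeriv γ D) (hγ : ∀ t, γ t ∈ pureStates ψ Q)
    (h0 : γ 0 = ketBra ψ) :
    ∑ g : Q, (g : Matrix.unitaryGroup (Label d N) ℂ).1ᴴ * D *
      (g : Matrix.unitaryGroup (Label d N) ℂ).1 = 0 := by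
  have hherm (t : ℝ) : (γ t)ᴴ = γ t := by
    obtain ⟨φ, hφ, h⟩ := (hγ t).1
    rw [h, conjTranspose_ketBra]
  have hsq (t : ℝ) : γ t * γ t = γ t := by
    obtain ⟨φ, hφ, h⟩ := (hγ t).1
    rw [h, ketBra_mul_self hφ]
  have hDh : Dᴴ = D := by
    have := hD.conjTranspose
    simp only [hherm] at this
    exact this.unique hD
  have hDsq : D * ketBra ψ + ketBra ψ * D = D := by
    have := hD.mul hD
    simp only [hsq] at this
    rw [h0] at this
    exact this.unique hD
  -- Sandwiching `Dψ + ψD = D` between two copies of `ψ` gives `2 ψDψ = ψDψ`.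
  have hmid : ketBra ψ * D * ketBra ψ = 0 := by
    have h := congrArg (fun A => ketBra ψ * A * ketBra ψ) hDsq
    simp only [mul_add, add_mul] at h
    rw [← mul_assoc (ketBra ψ) D (ketBra ψ), mul_assoc (ketBra ψ * D), ← mul_assoc (ketBra ψ)
      (ketBra ψ) D, ketBra_mul_self hnorm] at h
    simpa using h
  have hR : groupSum Q * D = (Fintype.card Q : ℂ) • ketBra ψ * D := by
    have h1 := (hasEntryDeriv_const (groupSum Q)).mul hD
    have h2 := (hasEntryDeriv_const ((Fintype.card Q : ℂ) • ketBra ψ)).mul hD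
    simp only [groupSum_mul_of_mem_pureStates hψ hnorm (hγ _)] at h1
    simpa using h1.unique h2
  have hRD : groupSum Q * D * ketBra ψ = 0 := by
    rw [hR, Matrix.smul_mul, Matrix.smul_mul, hmid, smul_zero]
  have hDR : ketBra ψ * D * groupSum Q = 0 := by
    have := congrArg Matrix.conjTranspose hRD
    rwa [Matrix.conjTranspose_mul, Matrix.conjTranspose_mul, conjTranspose_groupSum, hDh,
      conjTranspose_ketBra, Matrix.conjTranspose_zero, ← mul_assoc] at this
  calc _ = ∑ g : Q, ((g : Matrix.unitaryGroup (Label d N) ℂ).1ᴴ * (D * ketBra ψ) +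
        ketBra ψ * D * (g : Matrix.unitaryGroup (Label d N) ℂ).1) := by
        refine Finset.sum_congr rfl fun g _ => ?_
        nth_rw 1 [← hDsq]
        rw [mul_add, add_mul]
        congr 1
        · rw [mul_assoc, mul_assoc, ketBra_mul_of_mem hψ g.2]
        · rw [← mul_assoc, conjTranspose_mul_ketBra_of_mem hψ g.2]
    _ = (groupSum Q)ᴴ * (D * ketBra ψ) + ketBra ψ * D * groupSum Q := by
        rw [Finset.sum_add_distrib, ← Finset.sum_mul, ← Finset.mul_sum, groupSum,
          Matrix.conjTranspose_sum]
    _ = 0 := by rw [conjTranspose_groupSum, ← mul_assoc, hRD, hDR, add_zero]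

/-- A common phase of value and derivative drops out of the first-order term, so permuting the
family only up to phases is enough. -/
lemma norm_smul_sq_rpow_mul_inner (c z w : ℂ) (hc : ‖c‖ = 1) (b : ℝ) :
    (‖c * z‖ ^ 2) ^ b * inner ℝ (c * z) (c * w) = (‖z‖ ^ 2) ^ b * inner ℝ z w := by
  have h : c * w * (starRingEnd ℂ) (c * z) = w * (starRingEnd ℂ) z := by
    have : (starRingEnd ℂ) c * c = 1 := by rw [Complex.conj_mul', hc]; simp
    rw [map_mul]
    linear_combination (w * (starRingEnd ℂ) z) * this
  rw [norm_mul, hc, one_mul, Complex.inner, Complex.inner, h]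

/-- If `Q` permutes a family of operators up to phases, then the sum of the powers of the absolute
values of the expectations is flat or has a cusp. -/
lemma cuspOrFlat_sum_norm_trace_rpow (hψ : ψ ∈ stabilizedSpace Q) (hnorm : ‖ψ‖ = 1)
    {ι : Type*} [Fintype ι] {E : ι → Op d N}
    (hE : ∀ g ∈ Q, ∃ σ : Equiv.Perm ι, ∀ x, ∃ c : ℂ, ‖c‖ = 1 ∧
      (g : Op d N) * E x * (g : Op d N)ᴴ = c • E (σ x))
    {γ : ℝ → Op d N} (hsmooth : ∀ i j, ContDiff ℝ ∞ fun t => γ t i j)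
    (hγ : ∀ t, γ t ∈ pureStates ψ Q) (h0 : γ 0 = ketBra ψ) {b : ℝ} (hb : 0 < b) :
    CuspOrFlat fun t => ∑ x, ‖(γ t * E x).trace‖ ^ b := by
  obtain ⟨D, hD⟩ : ∃ D : Op d N, HasEntryDeriv γ D :=
    ⟨Matrix.of fun i j => deriv (fun t => γ t i j) 0, fun i j =>
      ((hsmooth i j).differentiable (by simp) 0).hasDerivAt⟩
  have hder (A : Op d N) : deriv (fun t => (γ t * A).trace) 0 = (D * A).trace := by
    simpa using (hD.mul (hasEntryDeriv_const A)).trace.deriv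
  refine cuspOrFlat_sum_norm_rpow (fun x => contDiff_trace_mul hsmooth (E x)) hb ?_
  simp only [hder, h0]
  -- The expectation `z` is kept as a separate argument: it is invariant under `Q`, so it can stay
  -- fixed while `A` is averaged, and `F z` is real linear in `A`.
  let F (z : ℂ) (A : Op d N) : ℝ := (‖z‖ ^ 2) ^ (b / 2 - 1) * inner ℝ z (D * A).trace
  have hg (g : Q) : ∑ x, F (ketBra ψ * E x).trace (E x) =
      ∑ x, F (ketBra ψ * E x).trace (g.1.1 * E x * g.1.1ᴴ) := by
    obtain ⟨σ, hσ⟩ := hE g g.2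
    rw [← Equiv.sum_comp σ]
    refine Finset.sum_congr rfl fun x _ => ?_
    obtain ⟨c, hc, h⟩ := hσ x
    have h1 : (ketBra ψ * E x).trace = c * (ketBra ψ * E (σ x)).trace := by
      have h2 : (ketBra ψ * (c • E (σ x))).trace = c * (ketBra ψ * E (σ x)).trace := by
        rw [Matrix.mul_smul, Matrix.trace_smul, smul_eq_mul]
      rw [← h2, ← h, ← mul_assoc, ← mul_assoc, ketBra_mul_of_mem hψ g.2,
        Matrix.trace_mul_comm (ketBra ψ * E x), ← mul_assoc, conjTranspose_mul_ketBra_of_mem hψ g.2]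
    simp only [F]
    rw [h1, h, Matrix.mul_smul, Matrix.trace_smul, smul_eq_mul,
      norm_smul_sq_rpow_mul_inner _ _ _ hc]
  have hsum : (Fintype.card Q : ℝ) * ∑ x, F (ketBra ψ * E x).trace (E x) = 0 := by
    calc _ = ∑ g : Q, ∑ x, F (ketBra ψ * E x).trace (g.1.1 * E x * g.1.1ᴴ) := by
          rw [← Finset.sum_congr rfl fun g _ => hg g]
          simp
      _ = ∑ x, (‖(ketBra ψ * E x).trace‖ ^ 2) ^ (b / 2 - 1) *
            inner ℝ (ketBra ψ * E x).trace (∑ g : Q, (D * (g.1.1 * E x * g.1.1ᴴ)).trace) := by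
          rw [Finset.sum_comm]
          simp only [F, inner_sum, Finset.mul_sum]
      _ = 0 := by
          refine Finset.sum_eq_zero fun x _ => ?_
          have : ∑ g : Q, (D * (g.1.1 * E x * g.1.1ᴴ)).trace =
              ((∑ g : Q, g.1.1ᴴ * D * g.1.1) * E x).trace := by
            rw [Finset.sum_mul, Matrix.trace_sum]
            refine Finset.sum_congr rfl fun g _ => ?_
            rw [← mul_assoc, Matrix.trace_mul_comm, ← mul_assoc, ← mul_assoc]
          rw [this, sum_conj_deriv_eq_zero hψ hnorm hD hγ h0]
          simp
  exact (mul_eq_zero.1 hsum).resolve_left (by exact_mod_cast Fintype.card_ne_zero)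

end

end

section

variable {d N : ℕ} [Fact d.Prime]

/-! ### Phases and Pauli operators -/

lemma norm_omegaPow (x : ZMod d) : ‖omegaPow x‖ = 1 := AddChar.norm_apply _ _

lemma omegaPow_ne_zero (x : ZMod d) : omegaPow x ≠ 0 :=
  norm_ne_zero_iff.1 (by rw [norm_omegaPow]; exact one_ne_zero)

lemma omegaPow_injective : Function.Injective (omegaPow : ZMod d → ℂ) :=
  ZMod.injective_stdAddChar

lemma norm_zeta_pow (m : ℕ) : ‖zeta d ^ m‖ = 1 := by
  have h : (Real.pi * Complex.I / d : ℂ) = ((Real.pi / d : ℝ) : ℂ) * Complex.I := by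
    push_cast
    ring
  rw [norm_pow, zeta, h, Complex.norm_exp_ofReal_mul_I, one_pow]

/-- The column of the basis vector `0` reveals the shift and the coefficient; the remaining columns
reveal the character defining the clock part. -/
lemma smul_pauliOp_inj {c c' : ℂ} (hc : c ≠ 0) {x y : Phase d N}
    (h : c • pauliOp x.1 x.2 = c' • pauliOp y.1 y.2) : x = y ∧ c = c' := by
  have entry (i j : Label d N) := congrFun (congrFun h i) j
  simp only [Matrix.smul_apply, pauliOp_apply, smul_eq_mul] at entry
  have h1 : x.1 = y.1 := by
    have := entry x.1 0
    by_contra hne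
    simp [omegaPow_zero, hne, hc] at this
  have h2 (j : Label d N) : c * omegaPow (x.2 ⬝ᵥ j) = c' * omegaPow (y.2 ⬝ᵥ j) := by
    simpa [h1] using entry (x.1 + j) j
  have h3 : c = c' := by simpa [omegaPow_zero] using h2 0
  refine ⟨Prod.ext h1 ?_, h3⟩
  refine dotProduct_eq _ _ fun j => omegaPow_injective (mul_left_cancel₀ hc ?_)
  rw [h2, ← h3]

lemma pauliOp_mem_unitaryGroup (a b : Label d N) :
    pauliOp a b ∈ Matrix.unitaryGroup (Label d N) ℂ := by
  rw [Matrix.mem_unitaryGroup_iff']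
  ext i j
  rw [Matrix.star_eq_conjTranspose, Matrix.mul_apply]
  simp only [Matrix.conjTranspose_apply, pauliOp_apply, Matrix.one_apply]
  rw [Finset.sum_eq_single (a + i) (fun k _ hk => by simp [hk]) (by simp)]
  by_cases h : i = j
  · subst h
    simp only [if_true]
    rw [Complex.star_def, Complex.conj_mul', norm_omegaPow]
    simp
  · simp [h]

/-- The unitary `X^a Z^b`. -/
noncomputable def pauliUnitary (x : Phase d N) : Matrix.unitaryGroup (Label d N) ℂ :=
  ⟨pauliOp x.1 x.2, pauliOp_mem_unitaryGroup x.1 x.2⟩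

lemma pauliUnitary_mem (x : Phase d N) : pauliUnitary x ∈ pauliGroup d N :=
  ⟨0, x.1, x.2, by simp [pauliUnitary]⟩

lemma trace_pauliOp (x : Phase d N) :
    (pauliOp x.1 x.2).trace = if x = 0 then (d : ℂ) ^ N else 0 := by
  simp only [Matrix.trace, Matrix.diag_apply, pauliOp_apply, right_eq_add]
  by_cases h1 : x.1 = 0
  · simp only [h1, if_true]
    by_cases h2 : x.2 = 0
    · have : x = 0 := Prod.ext h1 h2
      simp [this, omegaPow_zero, ZMod.card]
    · have hx : x ≠ 0 := fun h => h2 (by rw [h]; rfl)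
      rw [if_neg hx]
      let χ : AddChar (Label d N) ℂ :=
        { toFun := fun j => omegaPow (x.2 ⬝ᵥ j)
          map_zero_eq_one' := by simp [omegaPow_zero]
          map_add_eq_mul' := fun i j => by rw [dotProduct_add, omegaPow_add] }
      have hχ : χ ≠ 0 := fun h => h2 <| by
        refine dotProduct_eq _ _ fun j => omegaPow_injective ?_
        have := DFunLike.congr_fun h j
        simpa [χ, omegaPow_zero] using this
      exact AddChar.sum_eq_zero_iff_ne_zero.2 hχ
  · have hx : x ≠ 0 := fun h => h1 (by rw [h]; rfl)
    simp [h1, hx]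

/-! ### Action of the Clifford group on Pauli operators -/

lemma mem_pauliGroup_conj {g : Matrix.unitaryGroup (Label d N) ℂ} (hg : g ∈ cliffordGroup d N)
    {h : Matrix.unitaryGroup (Label d N) ℂ} (hh : h ∈ pauliGroup d N) :
    g * h * g⁻¹ ∈ pauliGroup d N :=
  (Subgroup.mem_normalizer_iff.1 hg h).1 hh

lemma exists_conj_pauliOp {g : Matrix.unitaryGroup (Label d N) ℂ} (hg : g ∈ cliffordGroup d N)
    (x : Phase d N) : ∃ (y : Phase d N) (c : ℂ), ‖c‖ = 1 ∧
      (g : Op d N) * pauliOp x.1 x.2 * (g : Op d N)ᴴ = c • pauliOp y.1 y.2 := by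
  obtain ⟨m, a, b, h⟩ := mem_pauliGroup_conj hg (pauliUnitary_mem x)
  exact ⟨(a, b), zeta d ^ m, norm_zeta_pow m, h⟩

lemma conj_injective (g : Matrix.unitaryGroup (Label d N) ℂ) {A B : Op d N}
    (h : (g : Op d N) * A * (g : Op d N)ᴴ = (g : Op d N) * B * (g : Op d N)ᴴ) : A = B := by
  have := congrArg (fun C => (g : Op d N)ᴴ * C * (g : Op d N)) h
  simpa only [mul_assoc, conjTranspose_mul_unitary, mul_one, ← mul_assoc ((g : Op d N)ᴴ) g,
    one_mul] using this

/-- Conjugation is injective and distinct labels give non-proportional Pauli operators, so the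
induced map on the finite phase space is a bijection. -/
lemma exists_perm_pauliOp {g : Matrix.unitaryGroup (Label d N) ℂ} (hg : g ∈ cliffordGroup d N) :
    ∃ σ : Equiv.Perm (Phase d N), ∀ x, ∃ c : ℂ, ‖c‖ = 1 ∧
      (g : Op d N) * pauliOp x.1 x.2 * (g : Op d N)ᴴ = c • pauliOp (σ x).1 (σ x).2 := by
  choose σ c hc h using exists_conj_pauliOp hg
  have hinj : Function.Injective σ := by
    intro x y hxy
    have hc0 (x) : c x ≠ 0 := norm_ne_zero_iff.1 (by rw [hc]; exact one_ne_zero)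
    refine (smul_pauliOp_inj (c := c y) (c' := c x) (hc0 y) (conj_injective g ?_)).1
    simp only [Matrix.mul_smul, Matrix.smul_mul, h, hxy]
    rw [smul_comm]
  exact ⟨Equiv.ofBijective σ (Finite.injective_iff_bijective.1 hinj), fun x => ⟨c x, hc x, h x⟩⟩

/-! ### Displacement operators and phase point operators in odd dimension -/

lemma symp_add_left (x y z : Phase d N) : symp (x + y) z = symp x z + symp y z := by
  simp only [symp, Prod.fst_add, Prod.snd_add, add_dotProduct]
  ring

lemma symp_add_right (x y z : Phase d N) : symp x (y + z) = symp x y + symp x z := by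
  simp only [symp, Prod.fst_add, Prod.snd_add, dotProduct_add]
  ring

lemma symp_swap (x y : Phase d N) : symp y x = -symp x y := by
  simp only [symp, dotProduct_comm y.1, dotProduct_comm y.2]
  ring

lemma symp_zero_right (x : Phase d N) : symp x 0 = 0 := by simp [symp]

lemma symp_zero_left (x : Phase d N) : symp 0 x = 0 := by simp [symp]

lemma symp_nondegenerate {x x' : Phase d N} (h : ∀ y, symp x y = symp x' y) : x = x' := by
  refine Prod.ext (dotProduct_eq _ _ fun j => ?_) (dotProduct_eq _ _ fun j => ?_)
  · simpa [symp] using h (0, j)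
  · simpa [symp] using h (j, 0)

/-- The additive character `y ↦ ω^{-⟨x,y⟩}` of phase space. -/
noncomputable def sympChar (x : Phase d N) : AddChar (Phase d N) ℂ where
  toFun y := omegaPow (-symp x y)
  map_zero_eq_one' := by rw [symp_zero_right, neg_zero, omegaPow_zero]
  map_add_eq_mul' y z := by rw [symp_add_right, neg_add, omegaPow_add]

lemma sympChar_apply (x y : Phase d N) : sympChar x y = omegaPow (-symp x y) := rfl

lemma sympChar_injective : Function.Injective (sympChar : Phase d N → AddChar (Phase d N) ℂ) :=
  fun _ _ h => symp_nondegenerate fun y =>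
    neg_injective (omegaPow_injective (DFunLike.congr_fun h y))

/-- A finite abelian group has as many characters as elements. This lets the phases of a Clifford
action be read as a translation of phase space. -/
lemma sympChar_surjective : Function.Surjective (sympChar : Phase d N → AddChar (Phase d N) ℂ) :=
  ((Fintype.bijective_iff_injective_and_card _).2
    ⟨sympChar_injective, AddChar.card_eq.symm⟩).2

lemma displacement_zero : displacement (0 : Phase d N) = 1 := by
  simp [displacement, omegaPow_zero, pauliOp_zero]

lemma two_ne_zero_of_odd (hd : Odd d) : (2 : ZMod d) ≠ 0 := by
  intro h
  have h2 : d ∣ 2 := (ZMod.natCast_eq_zero_iff 2 d).1 (by exact_mod_cast h)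
  rcases (Nat.dvd_prime Nat.prime_two).1 h2 with h | h
  · exact (Fact.out : d.Prime).one_lt.ne' h
  · subst h
    exact absurd hd (by decide)

/-- The half phase, available because `2` is invertible for odd `d`, makes the cocycle depend on the
symplectic form alone. -/
lemma displacement_mul (hd : Odd d) (x y : Phase d N) :
    displacement x * displacement y =
      omegaPow (-((2 : ZMod d)⁻¹ * symp x y)) • displacement (x + y) := by
  simp only [displacement, Matrix.smul_mul, Matrix.mul_smul, pauliOp_mul, smul_smul,
    ← omegaPow_add, Prod.fst_add, Prod.snd_add]
  congr 2
  have h2 : (2 : ZMod d)⁻¹ * 2 = 1 := inv_mul_cancel₀ (two_ne_zero_of_odd hd)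
  simp only [symp, add_dotProduct, dotProduct_add, dotProduct_comm y.1 x.2]
  linear_combination (-(x.2 ⬝ᵥ y.1)) * h2

lemma smul_displacement_inj {c c' : ℂ} (hc : c ≠ 0) {x y : Phase d N}
    (h : c • displacement x = c' • displacement y) : x = y ∧ c = c' := by
  simp only [displacement, smul_smul] at h
  obtain ⟨h1, h2⟩ := smul_pauliOp_inj (mul_ne_zero hc (omegaPow_ne_zero _)) h
  subst h1
  exact ⟨rfl, mul_right_cancel₀ (omegaPow_ne_zero _) h2⟩

lemma exists_conj_displacement {g : Matrix.unitaryGroup (Label d N) ℂ}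
    (hg : g ∈ cliffordGroup d N) (x : Phase d N) : ∃ (y : Phase d N) (c : ℂ), c ≠ 0 ∧
      (g : Op d N) * displacement x * (g : Op d N)ᴴ = c • displacement y := by
  obtain ⟨y, c, hc, h⟩ := exists_conj_pauliOp hg x
  have hc0 : c ≠ 0 := norm_ne_zero_iff.1 (by rw [hc]; exact one_ne_zero)
  refine ⟨y, omegaPow ((2 : ZMod d)⁻¹ * (x.1 ⬝ᵥ x.2)) * c *
    (omegaPow ((2 : ZMod d)⁻¹ * (y.1 ⬝ᵥ y.2)))⁻¹,
    mul_ne_zero (mul_ne_zero (omegaPow_ne_zero _) hc0) (inv_ne_zero (omegaPow_ne_zero _)), ?_⟩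
  rw [displacement, displacement, Matrix.mul_smul, Matrix.smul_mul, h, smul_smul, smul_smul,
    inv_mul_cancel_right₀ (omegaPow_ne_zero _)]

lemma conj_mul (g : Matrix.unitaryGroup (Label d N) ℂ) (A B : Op d N) :
    (g : Op d N) * (A * B) * (g : Op d N)ᴴ =
      ((g : Op d N) * A * (g : Op d N)ᴴ) * ((g : Op d N) * B * (g : Op d N)ᴴ) := by
  simp only [mul_assoc]
  rw [← mul_assoc ((g : Op d N)ᴴ) g, conjTranspose_mul_unitary, one_mul]

/-- A Clifford unitary acts on displacement operators by a symplectic permutation of phase space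
and a character. -/
lemma exists_symplectic_displacement (hd : Odd d) {g : Matrix.unitaryGroup (Label d N) ℂ}
    (hg : g ∈ cliffordGroup d N) :
    ∃ (σ : Equiv.Perm (Phase d N)) (u : AddChar (Phase d N) ℂ),
      (∀ x y, symp (σ x) (σ y) = symp x y) ∧
      ∀ x, (g : Op d N) * displacement x * (g : Op d N)ᴴ = u x • displacement (σ x) := by
  choose σ u hu h using exists_conj_displacement hg
  have hmul (x y : Phase d N) : σ x + σ y = σ (x + y) ∧
      u x * u y * omegaPow (-((2 : ZMod d)⁻¹ * symp (σ x) (σ y))) =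
        omegaPow (-((2 : ZMod d)⁻¹ * symp x y)) * u (x + y) := by
    refine smul_displacement_inj
      (mul_ne_zero (mul_ne_zero (hu x) (hu y)) (omegaPow_ne_zero _)) ?_
    have := conj_mul g (displacement x) (displacement y)
    rw [displacement_mul hd, Matrix.mul_smul, Matrix.smul_mul, h, h, h, Matrix.smul_mul,
      Matrix.mul_smul, displacement_mul hd, smul_smul, smul_smul, smul_smul] at this
    exact this.symm
  -- Comparing the product in both orders cancels the factors `u` and leaves the commutation phase
  -- `ω ^ symp`, which conjugation preserves.
  have hsymp (x y : Phase d N) : symp (σ x) (σ y) = symp x y := by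
    have h1 := (hmul x y).2
    have h2 := (hmul y x).2
    rw [symp_swap (σ x) (σ y), symp_swap x y, add_comm y x] at h2
    have h22 : (2 : ZMod d)⁻¹ + (2 : ZMod d)⁻¹ = 1 := by
      rw [← mul_two, inv_mul_cancel₀ (two_ne_zero_of_odd hd)]
    have h3 (z : ZMod d) : omegaPow (-((2 : ZMod d)⁻¹ * -z)) =
        omegaPow z * omegaPow (-((2 : ZMod d)⁻¹ * z)) := by
      rw [← omegaPow_add]
      congr 1
      linear_combination z * h22
    rw [h3, h3] at h2
    apply omegaPow_injective
    have hne : u x * u y * omegaPow (-((2 : ZMod d)⁻¹ * symp (σ x) (σ y))) ≠ 0 :=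
      mul_ne_zero (mul_ne_zero (hu x) (hu y)) (omegaPow_ne_zero _)
    apply mul_left_cancel₀ hne
    calc _ = u y * u x * (omegaPow (symp (σ x) (σ y)) *
          omegaPow (-((2 : ZMod d)⁻¹ * symp (σ x) (σ y)))) := by ring
      _ = _ := by rw [h2, h1]; ring
  have hadd (x y : Phase d N) : u (x + y) = u x * u y := by
    have h1 := (hmul x y).2
    rw [hsymp, mul_comm] at h1
    exact (mul_left_cancel₀ (omegaPow_ne_zero _) h1).symm
  have hzero : u 0 = 1 := by
    have := hadd 0 0
    rw [add_zero] at this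
    exact mul_left_cancel₀ (hu 0) (by rw [← this, mul_one])
  have hinj : Function.Injective σ := by
    intro x y hxy
    refine symp_nondegenerate fun z => ?_
    rw [← hsymp, hxy, hsymp]
  exact ⟨Equiv.ofBijective σ (Finite.injective_iff_bijective.1 hinj),
    { toFun := u, map_zero_eq_one' := hzero, map_add_eq_mul' := hadd }, hsymp, h⟩

/-- Phase point operators are a symplectic Fourier transform of displacements: the character
`sympChar v` shifts `x` to `x + v`, and the symplectic map then sends it to `σ (x + v)`. No phase
survives. -/
lemma exists_perm_phasePoint (hd : Odd d) {g : Matrix.unitaryGroup (Label d N) ℂ}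
    (hg : g ∈ cliffordGroup d N) :
    ∃ σ : Equiv.Perm (Phase d N), ∀ x,
      (g : Op d N) * phasePoint x * (g : Op d N)ᴴ = phasePoint (σ x) := by
  obtain ⟨σ, u, hσ, h⟩ := exists_symplectic_displacement hd hg
  obtain ⟨v, rfl⟩ := sympChar_surjective u
  refine ⟨(Equiv.addRight v).trans σ, fun x => ?_⟩
  rw [phasePoint, phasePoint, Matrix.mul_smul, Matrix.smul_mul, Finset.mul_sum, Finset.sum_mul]
  congr 1
  rw [← Equiv.sum_comp σ fun y => omegaPow (-symp _ y) • displacement y]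
  refine Finset.sum_congr rfl fun y _ => ?_
  rw [Matrix.mul_smul, Matrix.smul_mul, h, smul_smul, sympChar_apply, ← omegaPow_add,
    Equiv.trans_apply, hσ, Equiv.coe_addRight, symp_add_left, neg_add]

/-- Character orthogonality leaves only the displacement at `0`. It yields `sum_wigner`, which keeps
the argument of the logarithm in the mana positive. -/
lemma sum_phasePoint : ∑ x : Phase d N, phasePoint x = (d : ℂ) ^ N • (1 : Op d N) := by
  have hsum (y : Phase d N) : ∑ x : Phase d N, omegaPow (-symp x y) =
      if y = 0 then ((d : ℂ) ^ N) * (d : ℂ) ^ N else 0 := by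
    have : ∀ x, omegaPow (-symp x y) = sympChar (-y) x := fun x => by
      rw [sympChar_apply, ← symp_swap]
      congr 1
      simp [symp]
      ring
    simp only [this]
    rw [AddChar.sum_eq_ite]
    have h0 : sympChar (-y) = 0 ↔ y = 0 := by
      have : sympChar (0 : Phase d N) = 0 := by
        ext z
        simp [sympChar_apply, symp_zero_left, omegaPow_zero]
      rw [← this, sympChar_injective.eq_iff, neg_eq_zero]
    simp [h0, ZMod.card]
  have hd : (d : ℂ) ^ N ≠ 0 := pow_ne_zero _ (Nat.cast_ne_zero.2 (NeZero.ne d))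
  simp only [phasePoint]
  rw [← Finset.smul_sum, Finset.sum_comm]
  simp only [← Finset.sum_smul, hsum, ite_smul, zero_smul, Finset.sum_ite_eq', Finset.mem_univ,
    if_true, displacement_zero, smul_smul]
  rw [inv_mul_cancel_left₀ hd]

lemma sum_wigner (ρ : Op d N) : ∑ x : Phase d N, wigner ρ x = ρ.trace := by
  have hd : (d : ℂ) ^ N ≠ 0 := pow_ne_zero _ (Nat.cast_ne_zero.2 (NeZero.ne d))
  simp only [wigner]
  rw [← Finset.mul_sum, ← Matrix.trace_sum, ← Finset.mul_sum, sum_phasePoint, Matrix.mul_smul,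
    mul_one, Matrix.trace_smul, smul_eq_mul, inv_mul_cancel_left₀ hd]

end

section

variable {d N : ℕ} [Fact d.Prime]

/-! ### Stabilizer states -/

lemma ketBra_toEuclideanLin (A : Op d N) (s : Hilb d N) :
    ketBra (Matrix.toEuclideanLin A s) = A * ketBra s * Aᴴ := by
  rw [mul_ketBra, Matrix.vecMulVec_mul, ← Matrix.star_mulVec]
  rfl

lemma finite_pauliGroup : (pauliGroup d N : Set (Matrix.unitaryGroup (Label d N) ℂ)).Finite := by
  refine Set.Finite.of_finite_image (f := Subtype.val) (Set.Finite.subset (Set.finite_range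
    fun p : Fin (2 * d) × Phase d N => zeta d ^ (p.1 : ℕ) • pauliOp p.2.1 p.2.2) ?_)
    Subtype.val_injective.injOn
  rintro _ ⟨U, ⟨m, a, b, h⟩, rfl⟩
  have hd : 0 < d := NeZero.pos d
  refine ⟨(⟨m % (2 * d), Nat.mod_lt _ (by omega)⟩, (a, b)), ?_⟩
  rw [h, pow_eq_pow_mod m zeta_pow_two_mul]

/-- An element of the Pauli group with a nonzero fixed vector is the identity or traceless. -/
lemma trace_of_mem_pauliGroup {g : Matrix.unitaryGroup (Label d N) ℂ} (hg : g ∈ pauliGroup d N)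
    {s : Hilb d N} (hs : s ≠ 0) (hgs : Matrix.toEuclideanLin (g : Op d N) s = s) :
    (g : Op d N).trace = if g = 1 then (d : ℂ) ^ N else 0 := by
  split_ifs with h1
  · rw [h1, Matrix.UnitaryGroup.one_val, Matrix.trace_one]
    simp [ZMod.card]
  · obtain ⟨m, a, b, h⟩ := hg
    have htr := trace_pauliOp (d := d) (N := N) (a, b)
    rw [h, Matrix.trace_smul, htr, if_neg, smul_zero]
    intro hab
    obtain ⟨rfl, rfl⟩ := Prod.mk_eq_zero.1 hab
    rw [pauliOp_zero] at h
    apply h1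
    have hz : zeta d ^ m • s = s := by
      rw [h, map_smul] at hgs
      simpa using hgs
    have hz1 : zeta d ^ m = 1 := by
      have : (zeta d ^ m - 1) • s = 0 := by rw [sub_smul, hz, one_smul, sub_self]
      exact sub_eq_zero.1 ((smul_eq_zero.1 this).resolve_right hs)
    exact Subtype.ext (by rw [h, hz1, one_smul]; rfl)

open scoped ComplexOrder in
/-- The projector onto a stabilizer state is the normalized sum of its stabilizer group. -/
lemma ketBra_eq_smul_groupSum {S : Subgroup (Matrix.unitaryGroup (Label d N) ℂ)} [Fintype S]
    (hS : S ≤ pauliGroup d N) (hcard : Nat.card S = d ^ N) {s : Hilb d N} (hnorm : ‖s‖ = 1)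
    (hs : s ∈ stabilizedSpace S) : ketBra s = ((d : ℂ) ^ N)⁻¹ • groupSum S := by
  have hd : (d : ℂ) ^ N ≠ 0 := pow_ne_zero _ (Nat.cast_ne_zero.2 (NeZero.ne d))
  have hc : (Fintype.card S : ℂ) = (d : ℂ) ^ N := by
    rw [← Nat.card_eq_fintype_card, hcard, Nat.cast_pow]
  have hs0 : s ≠ 0 := fun h => by simp [h] at hnorm
  have htr : (groupSum S).trace = (d : ℂ) ^ N := by
    classical
    rw [groupSum, Matrix.trace_sum, Finset.sum_congr rfl fun (g : S) _ =>
      trace_of_mem_pauliGroup (hS g.2) hs0 (hs g g.2), Finset.sum_eq_single 1]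
    · simp
    · intro g _ hg
      exact if_neg fun h => hg (Subtype.ext h)
    · simp
  set A : Op d N := ((d : ℂ) ^ N)⁻¹ • groupSum S with hA
  have hAA : A * A = A := by
    rw [hA, Matrix.smul_mul, Matrix.mul_smul, groupSum_mul_self, hc, inv_smul_smul₀ hd]
  have hAh : Aᴴ = A := by
    rw [hA, Matrix.conjTranspose_smul, conjTranspose_groupSum]
    simp
  have hAk : A * ketBra s = ketBra s := by
    rw [hA, Matrix.smul_mul, groupSum_mul_ketBra hs, hc, inv_smul_smul₀ hd]
  have hkA : ketBra s * A = ketBra s := by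
    have := congrArg Matrix.conjTranspose hAk
    rwa [Matrix.conjTranspose_mul, hAh, conjTranspose_ketBra] at this
  have hAt : A.trace = 1 := by
    rw [hA, Matrix.trace_smul, htr, smul_eq_mul, inv_mul_cancel₀ hd]
  -- `A` is a projector of trace one that contains `ketBra s`, so the difference is a projector of
  -- trace zero.
  have hzero : ((A - ketBra s)ᴴ * (A - ketBra s)).trace = 0 := by
    rw [Matrix.conjTranspose_sub, hAh, conjTranspose_ketBra, sub_mul, mul_sub, mul_sub, hAA, hAk,
      hkA, ketBra_mul_self hnorm, sub_self, sub_zero, Matrix.trace_sub, hAt, trace_ketBra hnorm,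
      sub_self]
  exact (sub_eq_zero.1 (Matrix.trace_conjTranspose_mul_self_eq_zero_iff.1 hzero)).symm

/-- The projector is determined by the stabilizer group, a subset of the finite Pauli group. Passing
to projectors removes the arbitrary phases of the vectors and makes the fidelity a finite maximum.
-/
lemma finite_ketBra_stabilizerStates : (ketBra '' stabilizerStates d N).Finite := by
  have h : ∀ ρ : Op d N, ρ ∈ ketBra '' stabilizerStates d N →
      ∃ S : Subgroup (Matrix.unitaryGroup (Label d N) ℂ), S ≤ pauliGroup d N ∧
        Nat.card S = d ^ N ∧ ∃ s, ‖s‖ = 1 ∧ s ∈ stabilizedSpace S ∧ ρ = ketBra s := by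
    rintro _ ⟨s, ⟨hs, S, hS, -, hc, hsS⟩, rfl⟩
    exact ⟨S, hS, hc, s, hs, hsS, rfl⟩
  choose! f hf hcard s hnorm hs hρ using h
  refine Set.Finite.of_injOn (f := f) (t := {S | S ≤ pauliGroup d N}) hf ?_ ?_
  · intro ρ h1 ρ' h2 hff
    have : Finite (f ρ) := Nat.finite_of_card_ne_zero
      (by rw [hcard ρ h1]; exact pow_ne_zero _ (NeZero.ne d))
    have : Fintype (f ρ) := Fintype.ofFinite _
    rw [hρ ρ h1, hρ ρ' h2, ketBra_eq_smul_groupSum (hf ρ h1) (hcard ρ h1) (hnorm ρ h1) (hs ρ h1),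
      ketBra_eq_smul_groupSum (hff ▸ hf ρ' h2) (hff ▸ hcard ρ' h2) (hnorm ρ' h2)
        (hff ▸ hs ρ' h2)]
  · exact Set.Finite.of_finite_image (finite_pauliGroup.finite_subsets.subset (by
      rintro _ ⟨S, hS, rfl⟩
      exact hS)) (SetLike.coe_injective (A := Subgroup _)).injOn

lemma norm_toEuclideanLin_unitary (g : Matrix.unitaryGroup (Label d N) ℂ) (s : Hilb d N) :
    ‖Matrix.toEuclideanLin (g : Op d N) s‖ = ‖s‖ := by
  have h : inner ℂ (Matrix.toEuclideanLin (g : Op d N) s) (Matrix.toEuclideanLin (g : Op d N) s) =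
      inner ℂ s s := by
    rw [← LinearMap.adjoint_inner_right, ← Matrix.toEuclideanLin_conjTranspose_eq_adjoint,
      ← toEuclideanLin_mul_apply, conjTranspose_mul_unitary]
    simp
  rw [@norm_eq_sqrt_re_inner ℂ, h, ← @norm_eq_sqrt_re_inner ℂ]

lemma toEuclideanLin_mem_stabilizerStates {g : Matrix.unitaryGroup (Label d N) ℂ}
    (hg : g ∈ cliffordGroup d N) {s : Hilb d N} (hs : s ∈ stabilizerStates d N) :
    Matrix.toEuclideanLin (g : Op d N) s ∈ stabilizerStates d N := by
  obtain ⟨hnorm, S, hS, hcomm, hcard, hsS⟩ := hs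
  refine ⟨by rw [norm_toEuclideanLin_unitary, hnorm],
    S.map (MulAut.conj g).toMonoidHom, ?_, ?_, ?_, ?_⟩
  · rintro _ ⟨h, hh, rfl⟩
    exact mem_pauliGroup_conj hg (hS hh)
  · rintro _ ⟨h, hh, rfl⟩ _ ⟨k, hk, rfl⟩
    rw [← map_mul, ← map_mul, hcomm h hh k hk]
  · rw [← hcard]
    exact (Nat.card_congr (S.equivMapOfInjective _ (MulAut.conj g).injective).toEquiv).symm
  · rintro _ ⟨h, hh, rfl⟩
    have hgh : (((MulAut.conj g).toMonoidHom h : Matrix.unitaryGroup (Label d N) ℂ) : Op d N) *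
        (g : Op d N) = (g : Op d N) * (h : Op d N) := by
      rw [← Matrix.UnitaryGroup.mul_val, ← Matrix.UnitaryGroup.mul_val]
      congr 1
      simp
    rw [← toEuclideanLin_mul_apply, hgh, toEuclideanLin_mul_apply, hsS h hh]

lemma stabilizerFidelity_eq_sSup (ρ : Op d N) : stabilizerFidelity ρ =
    sSup ((fun E : Op d N => ‖(ρ * E).trace‖) '' (ketBra '' stabilizerStates d N)) := by
  rw [stabilizerFidelity, Set.image_image]
  simp only [inner_toEuclideanLin]

/-- The trace is `|⟨φ|s⟩|²`, so on pure states the absolute value can be replaced by the real part,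
which is real linear and hence differentiable along the curve. -/
lemma norm_trace_ketBra_mul_ketBra (φ s : Hilb d N) :
    ‖(ketBra φ * ketBra s).trace‖ = (ketBra φ * ketBra s).trace.re := by
  have h : (ketBra φ * ketBra s).trace = ((‖inner ℂ φ s‖ ^ 2 : ℝ) : ℂ) := by
    rw [← inner_toEuclideanLin, toEuclideanLin_ketBra, inner_smul_right, ← inner_conj_symm s φ,
      Complex.mul_conj']
    push_cast
    rfl
  rw [h, Complex.ofReal_re, Complex.norm_real, Real.norm_of_nonneg (by positivity)]

/-! ### Extremality of the three measures -/

variable {Q : Subgroup (Matrix.unitaryGroup (Label d N) ℂ)} {ψ : Hilb d N}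

lemma trace_of_mem_pureStates {ρ : Op d N} (h : ρ ∈ pureStates ψ Q) : ρ.trace = 1 := by
  obtain ⟨⟨φ, hφ, rfl⟩, -⟩ := h
  exact trace_ketBra hφ

lemma isExtremalOn_stabilizerFidelity [Finite Q] (hQ : Q ≤ cliffordGroup d N)
    (hψ : ψ ∈ stabilizedSpace Q) (hnorm : ‖ψ‖ = 1) :
    IsExtremalOn stabilizerFidelity (pureStates ψ Q) (ketBra ψ) := by
  have : Fintype Q := Fintype.ofFinite Q
  refine ⟨ketBra_mem_pureStates hnorm, fun γ hsmooth hγ h0 => ?_⟩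
  obtain ⟨D, hD⟩ : ∃ D : Op d N, HasEntryDeriv γ D :=
    ⟨Matrix.of fun i j => deriv (fun t => γ t i j) 0, fun i j =>
      ((hsmooth i j).differentiable (by simp) 0).hasDerivAt⟩
  have hder (E : Op d N) : HasDerivAt (fun t => (γ t * E).trace.re) (D * E).trace.re 0 := by
    have := (hD.mul (hasEntryDeriv_const E)).trace
    simp only [mul_zero, add_zero] at this
    exact Complex.reCLM.hasFDerivAt.comp_hasDerivAt 0 this
  have hfin := finite_ketBra_stabilizerStates (d := d) (N := N)
  set T := hfin.toFinset with hT
  have hfid (t : ℝ) : stabilizerFidelity (γ t) =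
      sSup ((fun E : Op d N => (γ t * E).trace.re) '' T) := by
    rw [stabilizerFidelity_eq_sSup, hT, hfin.coe_toFinset]
    congr 1
    refine Set.image_congr ?_
    rintro _ ⟨s, -, rfl⟩
    obtain ⟨φ, -, h⟩ := (hγ t).1
    rw [h, norm_trace_ketBra_mul_ketBra]
  simp only [hfid]
  -- Over an empty family the supremum is constant, so existence of stabilizer states need not be
  -- shown.
  rcases T.eq_empty_or_nonempty with hempty | hne
  · simp only [hempty, Finset.coe_empty, Set.image_empty]
    exact ⟨continuous_const, Or.inl (hasDerivAt_const _ _)⟩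
  simp only [← Finset.sup'_eq_csSup_image T hne]
  refine isExtremalPoint_sup' T hne
    (fun E _ => Complex.continuous_re.comp (contDiff_trace_mul hsmooth E).continuous)
    (fun E _ => (hder E).differentiableAt) fun E hE _ hEne => ?_
  simp only [(hder _).deriv] at hEne ⊢
  have hmem (g : Q) : g.1.1 * E * g.1.1ᴴ ∈ T := by
    rw [hT, Set.Finite.mem_toFinset] at hE ⊢
    obtain ⟨s, hs, rfl⟩ := hE
    exact ⟨_, toEuclideanLin_mem_stabilizerStates (hQ g.2) hs, ketBra_toEuclideanLin _ _⟩
  have hval (g : Q) : (γ 0 * (g.1.1 * E * g.1.1ᴴ)).trace.re = (γ 0 * E).trace.re := by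
    rw [h0, ← mul_assoc, ← mul_assoc, ketBra_mul_of_mem hψ g.2,
      Matrix.trace_mul_comm (ketBra ψ * E), ← mul_assoc, conjTranspose_mul_ketBra_of_mem hψ g.2]
  have hsum : ∑ g : Q, (D * (g.1.1 * E * g.1.1ᴴ)).trace.re = 0 := by
    have : ∑ g : Q, (D * (g.1.1 * E * g.1.1ᴴ)).trace =
        ((∑ g : Q, g.1.1ᴴ * D * g.1.1) * E).trace := by
      rw [Finset.sum_mul, Matrix.trace_sum]
      refine Finset.sum_congr rfl fun g _ => ?_
      rw [← mul_assoc, Matrix.trace_mul_comm, ← mul_assoc, ← mul_assoc]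
    rw [← Complex.re_sum, this, sum_conj_deriv_eq_zero hψ hnorm hD hγ h0]
    simp
  -- The identity contributes a nonzero term to a vanishing sum, so the orbit of `E` contains
  -- derivatives of both signs.
  have hone : (D * ((1 : Q).1.1 * E * (1 : Q).1.1ᴴ)).trace.re ≠ 0 := by simpa using hEne
  constructor
  · obtain ⟨g, -, hg⟩ := Finset.exists_pos_of_sum_zero_of_exists_nonzero _ hsum
      ⟨1, Finset.mem_univ _, hone⟩
    exact ⟨_, hmem g, hval g, hg⟩
  · obtain ⟨g, -, hg⟩ := Finset.exists_pos_of_sum_zero_of_exists_nonzero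
      (fun g : Q => -(D * (g.1.1 * E * g.1.1ᴴ)).trace.re) (by simp [hsum])
      ⟨1, Finset.mem_univ _, neg_ne_zero.2 hone⟩
    exact ⟨_, hmem g, hval g, neg_pos.1 hg⟩

lemma isExtremalOn_mana [Finite Q] (hd : Odd d) (hQ : Q ≤ cliffordGroup d N)
    (hψ : ψ ∈ stabilizedSpace Q) (hnorm : ‖ψ‖ = 1) :
    IsExtremalOn mana (pureStates ψ Q) (ketBra ψ) := by
  have : Fintype Q := Fintype.ofFinite Q
  refine ⟨ketBra_mem_pureStates hnorm, fun γ hsmooth hγ h0 => ?_⟩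
  -- The Wigner function sums to `Tr ρ = 1`, so its absolute values sum to at least `1`.
  have hpos (t : ℝ) : 0 < ∑ x, ‖wigner (γ t) x‖ := by
    refine one_pos.trans_le ?_
    calc (1 : ℝ) = ‖∑ x, wigner (γ t) x‖ := by
          rw [sum_wigner, trace_of_mem_pureStates (hγ t), norm_one]
      _ ≤ _ := norm_sum_le _ _
  have hcusp := cuspOrFlat_sum_norm_trace_rpow hψ hnorm
    (E := fun x => ((d : ℂ) ^ N)⁻¹ • phasePoint x) (fun g hg => by
      obtain ⟨σ, hσ⟩ := exists_perm_phasePoint hd (hQ hg)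
      exact ⟨σ, fun x => ⟨1, norm_one, by
        rw [Matrix.mul_smul, Matrix.smul_mul, hσ, one_smul]⟩⟩)
    hsmooth hγ h0 one_pos
  have heq (t : ℝ) (x : Phase d N) :
      (γ t * ((d : ℂ) ^ N)⁻¹ • phasePoint x).trace = wigner (γ t) x := by
    rw [Matrix.mul_smul, Matrix.trace_smul, smul_eq_mul, wigner]
  simp only [heq, Real.rpow_one] at hcusp
  have hcont : Continuous fun t => ∑ x, ‖wigner (γ t) x‖ :=
    continuous_finsetSum _ fun x _ =>
      (continuous_const.mul (contDiff_trace_mul hsmooth (phasePoint x)).continuous).norm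
  simpa [mana] using hcusp.isExtremalPoint_mul_log hcont hpos 1

lemma isExtremalOn_stabilizerRenyi [Finite Q] {α : ℝ} (hα : 0 < α) (hQ : Q ≤ cliffordGroup d N)
    (hψ : ψ ∈ stabilizedSpace Q) (hnorm : ‖ψ‖ = 1) :
    IsExtremalOn (stabilizerRenyi α) (pureStates ψ Q) (ketBra ψ) := by
  have : Fintype Q := Fintype.ofFinite Q
  refine ⟨ketBra_mem_pureStates hnorm, fun γ hsmooth hγ h0 => ?_⟩
  have hd : (0 : ℝ) < d := Nat.cast_pos.2 (NeZero.pos d)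
  set k : ℝ := ((d : ℝ) ^ ((1 - α) * (N : ℝ)))⁻¹ * (((d : ℝ) ^ N)⁻¹) ^ α with hk
  have hkpos : 0 < k := by positivity
  have heq (t : ℝ) : ((d : ℝ) ^ ((1 - α) * (N : ℝ)))⁻¹ * ∑ x, pauliProb (γ t) x ^ α =
      k * ∑ x : Phase d N, ‖(γ t * pauliOp x.1 x.2).trace‖ ^ (2 * α) := by
    rw [hk, mul_assoc, Finset.mul_sum _ _ ((((d : ℝ) ^ N)⁻¹) ^ α)]
    congr 1
    refine Finset.sum_congr rfl fun x _ => ?_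
    rw [pauliProb, Real.mul_rpow (by positivity) (by positivity), Real.rpow_mul (norm_nonneg _),
      Real.rpow_two]
  have hpos (t : ℝ) :
      0 < k * ∑ x : Phase d N, ‖(γ t * pauliOp x.1 x.2).trace‖ ^ (2 * α) := by
    -- The phase point `0` labels the identity, whose expectation is `Tr ρ = 1`.
    refine mul_pos hkpos (Finset.sum_pos' (fun x _ => by positivity) ⟨0, Finset.mem_univ _, ?_⟩)
    simp [pauliOp_zero, trace_of_mem_pureStates (hγ t)]
  have hcusp := (cuspOrFlat_sum_norm_trace_rpow hψ hnorm
    (E := fun x : Phase d N => pauliOp x.1 x.2) (fun g hg => exists_perm_pauliOp (hQ hg))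
    hsmooth hγ h0 (mul_pos two_pos hα)).const_mul hkpos
  have hcont : Continuous fun t =>
      k * ∑ x : Phase d N, ‖(γ t * pauliOp x.1 x.2).trace‖ ^ (2 * α) :=
    continuous_const.mul (continuous_finsetSum _ fun x _ =>
      (contDiff_trace_mul hsmooth _).continuous.norm.rpow_const fun _ => Or.inr (by positivity))
  simpa only [stabilizerRenyi, heq] using hcusp.isExtremalPoint_mul_log hcont hpos (1 - α)⁻¹

end

end QuditMagic

theorem mainTheorem2 (d N : ℕ) [Fact d.Prime]
    (Q : Subgroup (Matrix.unitaryGroup (QuditMagic.Label d N) ℂ)) (hfin : Finite Q)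
    (hQ : Q ≤ QuditMagic.cliffordGroup d N)
    (ψ : QuditMagic.Hilb d N) (hψ : ψ ∈ QuditMagic.stabilizedSpace Q) (hnorm : ‖ψ‖ = 1) :
    (Odd d →
      QuditMagic.IsExtremalOn QuditMagic.mana (QuditMagic.pureStates ψ Q)
        (QuditMagic.ketBra ψ)) ∧
    (∀ α : ℝ, 0 < α → α ≠ 1 →
      QuditMagic.IsExtremalOn (QuditMagic.stabilizerRenyi α) (QuditMagic.pureStates ψ Q)
        (QuditMagic.ketBra ψ)) ∧
    QuditMagic.IsExtremalOn QuditMagic.stabilizerFidelity (QuditMagic.pureStates ψ Q)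
      (QuditMagic.ketBra ψ) :=
  ⟨fun hd => QuditMagic.isExtremalOn_mana hd hQ hψ hnorm,
    fun _ hα _ => QuditMagic.isExtremalOn_stabilizerRenyi hα hQ hψ hnorm,
    QuditMagic.isExtremalOn_stabilizerFidelity hQ hψ hnorm⟩
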